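/- Fix integers $e\ge 2$ and $w\ge 0$. For a partition $\lambda=(\lambda_1\ge\lambda_2\ge\cdots)$ let $\beta(\lambda)=\{\lambda_i-i : i\ge 1\}\subset\mathbb Z$. Its elements, the *beads*, are the occupied positions of an abacus whose runners are the residue classes modulo $e$. For $b\in\mathbb Z$ let $\operatorname{wt}_\lambda(b)$ be the number of $x<b$ with $x\equiv b \pmod e$ and $x\notin\beta(\lambda)$. The *$e$-weight* of $\lambda$ is $\sum_{b\in\beta(\lambda)}\operatorname{wt}_\lambda(b)$; the *$e$-core* of $\lambda$ is the partition $\kappa$ with $\beta(\kappa)=\{b-\operatorname{wt}_\lambda(b)\,e : b\in\beta(\lambda)\}$; the *$e$-quotient* of $\lambda$ is $(\lambda^{(0)},\dots,\lambda^{(e-1)})$, where the parts of the partition $\lambda^{(r)}$ are the nonzero numbers $\operatorname{wt}_\lambda(b)$ for $b\in\beta(\lambda)$, $b\equiv r\pmod e$, counted with multiplicity. A *block of $e$-weight $w$* is the set of all partitions of $e$-weight $w$ with a given $e$-core. We call $\lambda$ a *hook-quotient* partition if every $\lambda^{(r)}$ is a hook, i.e. has second part at most $1$. Let $\lambda$ be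 a hook-quotient partition of $e$-weight $w$. Its *bead movements* are the $w$ pairs $(b;q)$ with $b\in\beta(\lambda)$ and $q=b-ie$, $0\le i<\operatorname{wt}_\lambda(b)$. List them as $(b_1;q_1)<\dots<(b_w;q_w)$, where $(b;q)<(b';q')$ means that $q<q'$, or $q=q'$ and $b<b'$. Put $\mathbf z(\lambda)=(z_1,\dots,z_w)$ with $z_i=|\{x\in\mathbb Z : q_i-e<x\le q_i,\ x\notin\beta(\lambda)\}|$. Let $\mathbf e_1,\dots,\mathbf e_w$ be the standard basis of $\mathbb Z^w$. For each residue class $j$ modulo $e$ such that $\{i : q_i\equiv j \pmod e\}=\{i_1<\dots<i_r\}$ is nonempty, let $l=\min\{s : b_{i_s}=b_{i_r}\}$ and put $$\epsilon^\lambda_{i_\gamma}=\begin{cases}\mathbf e_{i_\gamma}-\mathbf e_{i_{\gamma+1}}&\text{if }\gamma<l,\\ \mathbf e_{i_\gamma}&\text{if }\gamma=l,\\ \mathbf e_{i_\gamma}-\mathbf e_{i_{\gamma-1}}&\text{if }\gamma>l.\end{cases}$$ The *discrete parallelotope* of $\lambda$ is $\Pi(\lambda)=\{\mathbf z(\lambda)+\sum_{i\in\Gamma}\epsilon_i^\lambda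 : \Gamma\subseteq\{1,\dots,w\}\}\subset\mathbb Z^w$. For $\Omega\subseteq\mathbb Z^w$ let $\Omega_{\ge 4}$ be the set of *$4$-increasing* elements of $\Omega$, i.e. of those $(x_1,\dots,x_w)\in\Omega$ with $x_{i+1}-x_i\ge 4$ for all $1\le i<w$. **Proposition 8.1.** Let $B$ be a block of $e$-weight $w$. Then $$\bigcup_{\lambda}\Pi(\lambda)_{\ge 4}=\{(z_1,\dots,z_w)\in\mathbb Z^w : 0\le z_i\le e \text{ for all } i\}_{\ge 4},$$ where the union is over all hook-quotient partitions $\lambda$ in $B$. -/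

import Mathlib

noncomputable section

namespace Abacus

/-! Partitions are Young diagrams; `μ.rowLen i` is the part of `μ` with index `i + 1`. -/

/-- The set of `β`-numbers `{μ₁ - 1, μ₂ - 2, …}` of a partition: the occupied positions of its
abacus. Runner `r` of the `e`-abacus consists of the integers congruent to `r` modulo `e`. -/
def betaSet (μ : YoungDiagram) : Set ℤ :=
  Set.range fun i : ℕ => (μ.rowLen i : ℤ) - ((i : ℤ) + 1)

/-- The number of unoccupied positions above `b` on its runner, where "above" means smaller. -/
def wt (e : ℕ) (μ : YoungDiagram) (b : ℤ) : ℕ :=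
  Set.ncard {x : ℤ | x < b ∧ x ≡ b [ZMOD (e : ℤ)] ∧ x ∉ betaSet μ}

theorem finite_movedBeads (e : ℕ) (μ : YoungDiagram) :
    {b : ℤ | b ∈ betaSet μ ∧ 0 < wt e μ b}.Finite := by
  refine ((Finset.range (μ.colLen 0)).image
    (fun i : ℕ => (μ.rowLen i : ℤ) - ((i : ℤ) + 1))).finite_toSet.subset ?_
  have zero_row : ∀ i, μ.colLen 0 ≤ i → μ.rowLen i = 0 := by
    intro i hi
    by_contra h
    have h1 : (i, 0) ∈ μ := YoungDiagram.mem_iff_lt_rowLen.2 (Nat.pos_of_ne_zero h)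
    have h2 := YoungDiagram.mem_iff_lt_colLen.1 h1
    omega
  rintro b ⟨⟨i, rfl⟩, hb⟩
  by_cases hi : i < μ.colLen 0
  · simp only [Finset.coe_image, Set.mem_image, Finset.mem_coe, Finset.mem_range]
    exact ⟨i, hi, rfl⟩
  · exfalso
    rw [wt, Set.ncard_pos (Set.finite_of_ncard_pos hb)] at hb
    obtain ⟨x, hx, -, hx'⟩ := hb
    apply hx'
    have h0 := zero_row i (by omega)
    simp only [h0] at hx
    refine ⟨(-x - 1).toNat, ?_⟩
    have h1 := zero_row (-x - 1).toNat (by omega)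
    simp only [h1]
    omega

/-- The finite set of beads (elements of `betaSet μ`) of positive `e`-weight, i.e. of the beads
that move when the beads are slid up their runners. -/
def movedBeads (e : ℕ) (μ : YoungDiagram) : Finset ℤ :=
  (finite_movedBeads e μ).toFinset

/-- The `e`-weight of a partition: the sum of the `e`-weights of its beads (the beads outside
`movedBeads e μ` have weight zero). -/
def weight (e : ℕ) (μ : YoungDiagram) : ℕ :=
  ∑ b ∈ movedBeads e μ, wt e μ b

/-- The occupied positions after all beads of `μ` have been slid up their runners as far as
possible: the bead at `b` moves up by `wt e μ b` places. -/
def slidBeads (e : ℕ) (μ : YoungDiagram) : Set ℤ :=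
  (fun b : ℤ => b - (wt e μ b : ℤ) * (e : ℤ)) '' betaSet μ

/-- `κ` is the `e`-core of `μ`. -/
def IsCoreOf (e : ℕ) (κ μ : YoungDiagram) : Prop :=
  betaSet κ = slidBeads e μ

/-- `κ` is an `e`-core partition: it is its own `e`-core. -/
def IsCore (e : ℕ) (κ : YoungDiagram) : Prop :=
  IsCoreOf e κ κ

/-- The block of partitions with `e`-core `κ` and `e`-weight `w`. -/
def block (e : ℕ) (κ : YoungDiagram) (w : ℕ) : Set YoungDiagram :=
  {μ | IsCoreOf e κ μ ∧ weight e μ = w}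

/-- The component of the `e`-quotient of `μ` on runner `r`: the partition whose parts are the
`e`-weights of the beads on that runner (beads of weight zero contribute no part). -/
def quotient (e : ℕ) (μ : YoungDiagram) (r : ℤ) : YoungDiagram :=
  YoungDiagram.ofRowLens
    ((((movedBeads e μ).filter fun b => b ≡ r [ZMOD (e : ℤ)]).val.map (wt e μ)).sort
      (fun m n => n ≤ m))
    (Multiset.pairwise_sort _ _).sortedGE

/-- A hook: a partition whose second part is at most one (the empty partition is a hook). -/
def IsHook (μ : YoungDiagram) : Prop :=
  μ.rowLen 1 ≤ 1

/-- All components of the `e`-quotient are hooks. -/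
def IsHookQuotient (e : ℕ) (μ : YoungDiagram) : Prop :=
  ∀ r : ℕ, r < e → IsHook (quotient e μ (r : ℤ))

/-- The bead movements of `μ`. The movement `(b; q)` of the bead originally at `b`, starting at
`q = b - i e` with `0 ≤ i < wt e μ b`, is stored as the pair `(q, b)`, so that the required
total order (first by `q`, then by `b`) is the lexicographic order of `ℤ ×ₗ ℤ`. -/
def movements (e : ℕ) (μ : YoungDiagram) : Finset (ℤ ×ₗ ℤ) :=
  ((movedBeads e μ).sigma fun b => Finset.range (wt e μ b)).image
    fun p => toLex (p.1 - (p.2 : ℤ) * (e : ℤ), p.1)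

theorem wt_zero (μ : YoungDiagram) (b : ℤ) : wt 0 μ b = 0 := by
  have : {x : ℤ | x < b ∧ x ≡ b [ZMOD ((0 : ℕ) : ℤ)] ∧ x ∉ betaSet μ} = ∅ := by
    ext x
    simp only [Set.mem_ofPred_eq, Set.mem_empty_iff_false, iff_false]
    rintro ⟨h1, h2, -⟩
    simp [Int.ModEq] at h2
    omega
  rw [wt, this, Set.ncard_empty]

theorem card_movements (e : ℕ) (μ : YoungDiagram) : (movements e μ).card = weight e μ := by
  rw [movements, Finset.card_image_of_injOn, Finset.card_sigma]
  · simp [weight]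
  · rintro ⟨b, i⟩ hp ⟨c, j⟩ hq h
    simp only [Finset.coe_sigma, Set.mem_sigma_iff, Finset.mem_coe, Finset.mem_range] at hp hq
    have h' := toLex.injective h
    simp only [Prod.mk.injEq] at h'
    obtain ⟨h1, rfl⟩ := h'
    have he : (e : ℤ) ≠ 0 := by
      intro he
      have : e = 0 := by exact_mod_cast he
      subst this
      simp [wt_zero] at hp
    have : (i : ℤ) = j := mul_right_cancel₀ he (by linarith)
    have : i = j := by exact_mod_cast this
    subst this
    rfl

section Labels

variable (e : ℕ) (μ : YoungDiagram) {w : ℕ} (h : weight e μ = w)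

/-- The increasing enumeration `(b₁; q₁) < ⋯ < (b_w; q_w)` of the bead movements, with index
set `Fin w`. -/
def movement : Fin w ↪o ℤ ×ₗ ℤ :=
  (movements e μ).orderEmbOfFin ((card_movements e μ).trans h)

/-- The starting position `q_i` of the `i`-th bead movement. -/
def start (i : Fin w) : ℤ := (ofLex (movement e μ h i)).1

/-- The original position `b_i` of the bead of the `i`-th bead movement. -/
def bead (i : Fin w) : ℤ := (ofLex (movement e μ h i)).2

/-- The vector `z(μ) ∈ ℤ^w`: its `i`-th coordinate is the number of unoccupied positions in the
interval `(q_i - e, q_i]`. -/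
def zLabel (i : Fin w) : ℤ :=
  ((Set.Ioc (start e μ h i - (e : ℤ)) (start e μ h i) \ betaSet μ).ncard : ℤ)

/-- The indices of the bead movements on the same runner as the `i`-th one. -/
def sameRunner (i : Fin w) : Finset (Fin w) :=
  Finset.univ.filter fun k => start e μ h k ≡ start e μ h i [ZMOD (e : ℤ)]

theorem self_mem_sameRunner (i : Fin w) : i ∈ sameRunner e μ h i :=
  Finset.mem_filter.2 ⟨Finset.mem_univ i, Int.ModEq.refl _⟩

/-- The last bead movement on the runner of the `i`-th one. -/
def lastOnRunner (i : Fin w) : Fin w :=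
  (sameRunner e μ h i).max' ⟨i, self_mem_sameRunner e μ h i⟩

theorem lastOnRunner_mem (i : Fin w) :
    lastOnRunner e μ h i ∈ (sameRunner e μ h i).filter
      fun k => bead e μ h k = bead e μ h (lastOnRunner e μ h i) :=
  Finset.mem_filter.2 ⟨Finset.max'_mem _ _, rfl⟩

/-- The first bead movement, on the runner of the `i`-th one, that moves the same bead as the
last bead movement on this runner; this is the final movement of the bottom bead. -/
def pivot (i : Fin w) : Fin w :=
  ((sameRunner e μ h i).filter
    fun k => bead e μ h k = bead e μ h (lastOnRunner e μ h i)).min'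
      ⟨_, lastOnRunner_mem e μ h i⟩

theorem pivot_mem (i : Fin w) : pivot e μ h i ∈ sameRunner e μ h i :=
  (Finset.mem_filter.1 (Finset.min'_mem _ ⟨_, lastOnRunner_mem e μ h i⟩)).1

/-- The modified basis vector of index `i`. With `i_1 < ⋯ < i_r` the bead movements on the
runner and `i_l` the pivot, it is `e_i - e_(next)` before the pivot, `e_i` at the pivot, and
`e_i - e_(previous)` after the pivot, "next" and "previous" being taken on the runner. -/
def modifiedBasis (i : Fin w) : Fin w → ℤ :=
  if h1 : i < pivot e μ h i then
    Pi.single i 1 - Pi.single (((sameRunner e μ h i).filter fun k => i < k).min'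
      ⟨_, Finset.mem_filter.2 ⟨pivot_mem e μ h i, h1⟩⟩) 1
  else if h2 : pivot e μ h i < i then
    Pi.single i 1 - Pi.single (((sameRunner e μ h i).filter fun k => k < i).max'
      ⟨_, Finset.mem_filter.2 ⟨pivot_mem e μ h i, h2⟩⟩) 1
  else Pi.single i 1

/-- The discrete parallelotope `Π(μ)`, the set of all `z(μ) + ∑_{i ∈ Γ} ε_i` for sets `Γ` of
indices. -/
def parallelotope : Set (Fin w → ℤ) :=
  Set.range fun Γ : Finset (Fin w) => zLabel e μ h + ∑ i ∈ Γ, modifiedBasis e μ h i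

end Labels

/-- The set of `m`-increasing elements of `Ω`: consecutive coordinates grow by at least `m`. -/
def increasing {n : ℕ} (m : ℤ) (Ω : Set (Fin n → ℤ)) : Set (Fin n → ℤ) :=
  {z | z ∈ Ω ∧ ∀ i j : Fin n, (j : ℕ) = (i : ℕ) + 1 → m ≤ z j - z i}

end Abacus

end

namespace Abacus

/-! That the parallelotopes stay in the cube is a statement about the extreme coordinates, since
4-increasing vectors are monotone. The last movement starts at a bead, so its label is at most `e -
1`, and a sum of vectors `ε` adds at most 1. The first coordinate can lose at most 1, and only when
`q_1` is unoccupied, so that its label is at least 1 (`increasing_parallelotope_subset`).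

Conversely, the starting positions of the required partition are found by minimising a convex
energy. Let `T` be the bead set of the core and `F x` the number of gaps of `T` in `(x - e, x]`.
Particles at `q_1 ≤ ... ≤ q_w` feel a potential `Φ` of slope `F`, constant forces `z_i` and a
pairwise repulsion of range `e`. As `F` rises from 0 to `e` and `0 ≤ z_i ≤ e`, minimisers exist; the
gaps of 4 in `z` prevent collisions (`IsGroundState.strictMono`). Sliding loose groups until they
lock gives a rigid minimiser (`exists_rigid_isGroundState`), and rigidity makes its set `Q` of
positions anchored: on each runner, empty or an interval containing the first gap of the core
(`isAnchored_of_rigid`).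

Such a `Q` is the set of starting positions of a hook-quotient partition `λ` in the block, with bead
indicator `1_T + 1_Q - 1_{Q-e}` (`exists_start_eq_of_anchored`), and `z(λ)` is read off from the
slopes of the energy (`zLabel_eq`). Root each interval at the first gap; then `ε_j` is `e_j` minus
`e_parent` (`modifiedBasis_eq`), so the coefficients of `z - z(λ)` are its sums over subtrees.
Moving a whole subtree by `1` or `-1` cannot lower the energy, which forces each of these sums to be
0 or 1 (`exists_coefficients`). -/

/-! ### A convex minimisation problem -/

section Energy

variable {w : ℕ}

/-- The energy of `w` particles on the line in a convex potential `Φ`, each subject to a constant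
force, with a pairwise repulsion of range `e`. -/
def energy (e : ℤ) (Φ : ℤ → ℤ) (z q : Fin w → ℤ) : ℤ :=
  ∑ i, (Φ (q i) - z i * q i) + ∑ i, ∑ j, if i < j then max (q i - q j) (-e) else 0

/-- Move the particles with index in `C` by `δ`. -/
def shift (C : Finset (Fin w)) (δ : ℤ) (q : Fin w → ℤ) (i : Fin w) : ℤ :=
  q i + if i ∈ C then δ else 0

/-- The change of energy when the particles in `C` move up by one. -/
def upSlope (e : ℤ) (F : ℤ → ℤ) (z q : Fin w → ℤ) (C : Finset (Fin w)) : ℤ :=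
  ∑ i ∈ C, (F (q i) - z i) + ∑ i, ∑ j, if i < j then
    (if i ∈ C ∧ q j - q i ≤ e then 1 else 0) - (if j ∈ C ∧ q j - q i < e then 1 else 0)
      - (if i ∈ C ∧ j ∈ C ∧ q j - q i = e then 1 else 0) else 0

/-- The number of jumps of `F` at particles in `C`, plus the number of pairs at distance exactly
`e` that are separated by `C`. -/
def kinks (e : ℤ) (F : ℤ → ℤ) (q : Fin w → ℤ) (C : Finset (Fin w)) : ℤ :=
  ∑ i ∈ C, (F (q i) - F (q i - 1)) + ∑ i, ∑ j,
    if i < j ∧ q j - q i = e ∧ ¬(i ∈ C ↔ j ∈ C) then 1 else 0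

/-- A pair `i < j` at distance `d` contributes `-min d e`. Raising `i` costs 1 if `d ≤ e`, raising
`j` gains 1 if `d < e`; raising both changes nothing, hence the correction at `d = e`. -/
theorem energy_shift_one {e : ℤ} {Φ F : ℤ → ℤ} (hΦ : ∀ x, Φ (x + 1) - Φ x = F x)
    (z q : Fin w → ℤ) (C : Finset (Fin w)) :
    energy e Φ z (shift C 1 q) - energy e Φ z q = upSlope e F z q C := by
  unfold energy upSlope shift
  rw [add_sub_add_comm, ← Finset.sum_sub_distrib, ← Finset.sum_sub_distrib]
  congr 1
  · rw [← Finset.sum_subset (Finset.subset_univ C)]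
    · refine Finset.sum_congr rfl fun i hi => ?_
      rw [if_pos hi, ← hΦ]; ring
    · intro i _ hi
      simp [hi]
  · refine Finset.sum_congr rfl fun i _ => ?_
    rw [← Finset.sum_sub_distrib]
    refine Finset.sum_congr rfl fun j _ => ?_
    by_cases hi : i ∈ C <;> by_cases hj : j ∈ C <;> by_cases hij : i < j <;>
      simp only [hi, hj, hij, if_true, if_false, true_and, false_and, and_false] <;>
      (try split_ifs) <;> omega

/-- Thus `kinks` is the second difference of the energy in the direction of `C`. -/
theorem energy_shift_neg_one {e : ℤ} {Φ F : ℤ → ℤ} (hΦ : ∀ x, Φ (x + 1) - Φ x = F x)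
    (z q : Fin w → ℤ) (C : Finset (Fin w)) :
    energy e Φ z (shift C (-1) q) - energy e Φ z q = kinks e F q C - upSlope e F z q C := by
  unfold energy upSlope shift kinks
  rw [add_sub_add_comm, ← Finset.sum_sub_distrib, ← Finset.sum_sub_distrib, add_sub_add_comm,
    ← Finset.sum_sub_distrib, ← Finset.sum_sub_distrib]
  congr 1
  · rw [← Finset.sum_subset (Finset.subset_univ C)]
    · refine Finset.sum_congr rfl fun i hi => ?_
      have := hΦ (q i - 1)
      rw [sub_add_cancel] at this
      rw [if_pos hi, ← this, ← sub_eq_add_neg]; ring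
    · intro i _ hi
      simp [hi]
  · refine Finset.sum_congr rfl fun i _ => ?_
    rw [← Finset.sum_sub_distrib, ← Finset.sum_sub_distrib]
    refine Finset.sum_congr rfl fun j _ => ?_
    by_cases hi : i ∈ C <;> by_cases hj : j ∈ C <;> by_cases hij : i < j <;>
      simp only [hi, hj, hij, if_true, if_false, true_and, false_and, and_true, and_false,
        iff_true, not_true, not_false_iff, iff_false] <;>
      (try split_ifs) <;> omega

/-- `q` minimises the energy among weakly increasing configurations. -/
def IsGroundState (e : ℤ) (Φ : ℤ → ℤ) (z q : Fin w → ℤ) : Prop :=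
  Monotone q ∧ ∀ p, Monotone p → energy e Φ z q ≤ energy e Φ z p

theorem exists_lowerBound_of_unimodal {f : ℤ → ℤ} {lo hi : ℤ}
    (hlo : ∀ x, x < lo → f (x + 1) ≤ f x) (hhi : ∀ x, hi ≤ x → f x ≤ f (x + 1)) :
    ∃ K, ∀ x, K ≤ f x := by
  obtain ⟨K, hK⟩ : ∃ K, ∀ x ∈ Set.Icc lo (max lo hi), K ≤ f x := by
    obtain ⟨K, hK⟩ := ((Set.finite_Icc lo (max lo hi)).image f).bddBelow
    exact ⟨K, fun x hx => hK ⟨x, hx, rfl⟩⟩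
  refine ⟨K, fun x => ?_⟩
  rcases le_total x lo with h | h
  · have : ∀ y, y ≤ lo → f lo ≤ f y := by
      intro y hy
      induction y, hy using Int.leInductionDown with
      | base => exact le_rfl
      | pred n hn ih =>
        have := hlo (n - 1) (by omega)
        rw [sub_add_cancel] at this
        omega
    exact (hK lo ⟨le_rfl, le_max_left _ _⟩).trans (this x h)
  · rcases le_total x (max lo hi) with h' | h'
    · exact hK x ⟨h, h'⟩
    · have : ∀ y, max lo hi ≤ y → f (max lo hi) ≤ f y := by
        intro y hy
        induction y, hy using Int.leInduction with
        | base => exact le_rfl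
        | succ n hn ih => exact ih.trans (hhi n (by omega))
      exact (hK _ ⟨le_max_left _ _, le_rfl⟩).trans (this x h')

/-- The slope `F x - z i` is nonpositive far to the left and nonnegative far to the right by the
cube condition, and pair terms are at least `-e`; an integer-valued function bounded below attains
its minimum. -/
theorem exists_isGroundState {e : ℤ} {Φ F : ℤ → ℤ} (hΦ : ∀ x, Φ (x + 1) - Φ x = F x)
    {lo hi : ℤ} (hlo : ∀ x, x < lo → F x = 0) (hhi : ∀ x, hi ≤ x → F x = e)
    {z : Fin w → ℤ} (hz : ∀ i, 0 ≤ z i ∧ z i ≤ e) :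
    ∃ q, IsGroundState e Φ z q := by
  have h1 : ∀ i, ∃ K, ∀ x, K ≤ Φ x - z i * x := fun i =>
    exists_lowerBound_of_unimodal (lo := lo) (hi := hi)
      (fun x hx => by have := hΦ x; have := hlo x hx; have := hz i; linarith)
      (fun x hx => by have := hΦ x; have := hhi x hx; have := hz i; linarith)
  choose K hK using h1
  let P : ℤ → Prop := fun t => ∃ q : Fin w → ℤ, Monotone q ∧ energy e Φ z q = t
  obtain ⟨t, ⟨q, hq, rfl⟩, ht⟩ := Int.exists_least_of_bdd (P := P)
    ⟨∑ i, K i + ∑ i : Fin w, ∑ j : Fin w, if i < j then -e else 0, by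
      rintro t ⟨q, -, rfl⟩
      unfold energy
      refine add_le_add (Finset.sum_le_sum fun i _ => hK i _)
        (Finset.sum_le_sum fun i _ => Finset.sum_le_sum fun j _ => ?_)
      split_ifs <;> simp⟩
    ⟨_, fun _ => 0, monotone_const, rfl⟩
  exact ⟨q, hq, fun p hp => ht _ ⟨p, hp, rfl⟩⟩

theorem add_four_le_of_lt {z : Fin w → ℤ}
    (hz : ∀ i j : Fin w, (j : ℕ) = (i : ℕ) + 1 → 4 ≤ z j - z i) {i j : Fin w} (hij : i < j) :
    z i + 4 ≤ z j := by
  obtain ⟨j, hj⟩ := j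
  induction j with
  | zero => exact absurd hij (Nat.not_lt_zero _)
  | succ n ih =>
    have h1 := hz ⟨n, by omega⟩ ⟨n + 1, hj⟩ rfl
    rcases (Nat.lt_succ_iff.1 (Fin.lt_def.1 hij)).lt_or_eq with h | h
    · have := ih (by omega) h
      omega
    · rw [show i = ⟨n, by omega⟩ from Fin.ext h]
      omega


theorem upSlope_eq (e : ℤ) (F : ℤ → ℤ) (z q : Fin w → ℤ) (C : Finset (Fin w)) :
    upSlope e F z q C = ∑ i ∈ C, (F (q i) - z i + ∑ j, (if i < j ∧ q j - q i ≤ e then 1 else 0)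
      - ∑ j, if j < i ∧ q i - q j < e then 1 else 0)
      - ∑ i, ∑ j, if i < j ∧ i ∈ C ∧ j ∈ C ∧ q j - q i = e then 1 else 0 := by
  have h : ∀ i j : Fin w, (if i < j then
      (if i ∈ C ∧ q j - q i ≤ e then (1 : ℤ) else 0) - (if j ∈ C ∧ q j - q i < e then 1 else 0)
      - (if i ∈ C ∧ j ∈ C ∧ q j - q i = e then 1 else 0) else 0)
      = (if i ∈ C then (if i < j ∧ q j - q i ≤ e then 1 else 0) else 0)
        - (if j ∈ C then (if i < j ∧ q j - q i < e then 1 else 0) else 0)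
        - (if i < j ∧ i ∈ C ∧ j ∈ C ∧ q j - q i = e then 1 else 0) := by
    intro i j
    by_cases hi : i ∈ C <;> by_cases hj : j ∈ C <;> by_cases hij : i < j <;>
      simp only [hi, hj, hij, if_true, if_false, true_and, false_and, and_false, sub_self]
  unfold upSlope
  simp only [h, Finset.sum_sub_distrib, Finset.sum_add_distrib]
  rw [Finset.sum_comm (f := fun i j : Fin w =>
    if j ∈ C then (if i < j ∧ q j - q i < e then (1 : ℤ) else 0) else 0)]
  have h2 : ∀ f : Fin w → Fin w → ℤ,
      ∑ i, ∑ j, (if i ∈ C then f i j else 0) = ∑ i ∈ C, ∑ j, f i j := fun f => by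
    rw [← Finset.sum_subset (Finset.subset_univ C) fun i _ hi => by simp [hi]]
    exact Finset.sum_congr rfl fun i hi => by simp [hi]
  rw [h2 fun i j => if i < j ∧ q j - q i ≤ e then 1 else 0,
    h2 fun i j => if j < i ∧ q i - q j < e then 1 else 0]
  ring

theorem upSlope_singleton (e : ℤ) (F : ℤ → ℤ) (z q : Fin w → ℤ) (c : Fin w) :
    upSlope e F z q {c} = F (q c) - z c + ∑ j, (if c < j ∧ q j - q c ≤ e then 1 else 0)
      - ∑ j, if j < c ∧ q c - q j < e then 1 else 0 := by
  have h : ∀ i j, ¬(i < j ∧ i ∈ ({c} : Finset (Fin w)) ∧ j ∈ ({c} : Finset (Fin w)) ∧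
      q j - q i = e) := by
    intro i j
    simp only [Finset.mem_singleton]
    rintro ⟨h, rfl, rfl, -⟩
    exact lt_irrefl _ h
  rw [upSlope_eq, Finset.sum_singleton]
  simp only [h, if_false, Finset.sum_const_zero, sub_zero]

theorem kinks_singleton (e : ℤ) (F : ℤ → ℤ) (q : Fin w → ℤ) (c : Fin w) :
    kinks e F q {c} = F (q c) - F (q c - 1) + ∑ j, (if c < j ∧ q j - q c = e then 1 else 0)
      + ∑ j, if j < c ∧ q c - q j = e then 1 else 0 := by
  have h : ∀ i j : Fin w, (if i < j ∧ q j - q i = e ∧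
      ¬(i ∈ ({c} : Finset (Fin w)) ↔ j ∈ ({c} : Finset (Fin w))) then (1 : ℤ) else 0)
      = (if i = c then (if c < j ∧ q j - q c = e then 1 else 0) else 0)
        + (if j = c then (if i < c ∧ q c - q i = e then 1 else 0) else 0) := by
    intro i j
    simp only [Finset.mem_singleton]
    by_cases hi : i = c <;> by_cases hj : j = c <;> by_cases hij : i < j <;>
      simp_all
  unfold kinks
  simp only [h, Finset.sum_add_distrib, Finset.sum_singleton]
  rw [Finset.sum_comm]
  simp only [Finset.sum_ite_eq', Finset.mem_univ, if_true]
  ring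

theorem IsGroundState.zero_le_upSlope {e : ℤ} {Φ F : ℤ → ℤ} (hΦ : ∀ x, Φ (x + 1) - Φ x = F x)
    {z q : Fin w → ℤ} (hq : IsGroundState e Φ z q) {C : Finset (Fin w)}
    (hC : Monotone (shift C 1 q)) : 0 ≤ upSlope e F z q C := by
  rw [← energy_shift_one hΦ]
  linarith [hq.2 _ hC]

theorem IsGroundState.upSlope_le_kinks {e : ℤ} {Φ F : ℤ → ℤ} (hΦ : ∀ x, Φ (x + 1) - Φ x = F x)
    {z q : Fin w → ℤ} (hq : IsGroundState e Φ z q) {C : Finset (Fin w)}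
    (hC : Monotone (shift C (-1) q)) : upSlope e F z q C ≤ kinks e F q C := by
  linarith [energy_shift_neg_one (e := e) hΦ z q C, hq.2 _ hC]

/-- The constant 4 comes from here. On a most crowded site, with `m ≥ 2` particles, push the last
particle `b` up and the first particle `a` down. The `m - 1` companions enter both neighbour counts,
which gains `2 * (m - 1)`, while the kinks are at most `1 + 2 * m` because no site at distance `e`
is more crowded. Hence `z b - z a ≤ 3`. -/
theorem IsGroundState.strictMono {e : ℤ} (he : 0 < e) {Φ F : ℤ → ℤ}
    (hΦ : ∀ x, Φ (x + 1) - Φ x = F x) (hF : ∀ x, F x - F (x - 1) ≤ 1) {z q : Fin w → ℤ}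
    (hz : ∀ i j : Fin w, (j : ℕ) = (i : ℕ) + 1 → 4 ≤ z j - z i)
    (hq : IsGroundState e Φ z q) : StrictMono q := by
  by_contra hcon
  have hinj : ¬ Function.Injective q := fun h => hcon (hq.1.strictMono_of_injective h)
  obtain ⟨k, l, hkl, hne⟩ : ∃ k l, q k = q l ∧ k ≠ l := by
    simpa [Function.Injective] using hinj
  have : Nonempty (Fin w) := ⟨k⟩
  let fib : ℤ → Finset (Fin w) := fun x => Finset.univ.filter fun j => q j = x
  have mem_fib : ∀ x j, j ∈ fib x ↔ q j = x := fun x j => by simp [fib]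
  obtain ⟨c, hc⟩ := Finite.exists_max fun i => (fib (q i)).card
  set x := q c with hx
  have hm : 1 < (fib x).card :=
    (Finset.one_lt_card.2 ⟨k, (mem_fib _ _).2 rfl, l, (mem_fib _ _).2 hkl.symm, hne⟩).trans_le
      (hc k)
  have hfib : ∀ y, (∑ j, if q j = y then (1 : ℤ) else 0) ≤ (fib x).card := by
    intro y
    rw [← Finset.sum_filter, Finset.sum_const, nsmul_eq_mul, mul_one]
    by_cases hy : ∃ j, q j = y
    · obtain ⟨j, rfl⟩ := hy
      exact_mod_cast hc j
    · rw [Finset.filter_false_of_mem fun j _ hj => hy ⟨j, hj⟩]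
      simp
  have hnonempty : (fib x).Nonempty := Finset.card_pos.1 (by omega)
  obtain ⟨a, ha, ha'⟩ : ∃ a, q a = x ∧ ∀ j, q j = x → a ≤ j :=
    ⟨(fib x).min' hnonempty, (mem_fib _ _).1 (Finset.min'_mem _ _),
      fun j hj => Finset.min'_le _ _ ((mem_fib _ _).2 hj)⟩
  obtain ⟨b, hb, hb'⟩ : ∃ b, q b = x ∧ ∀ j, q j = x → j ≤ b :=
    ⟨(fib x).max' hnonempty, (mem_fib _ _).1 (Finset.max'_mem _ _),
      fun j hj => Finset.le_max' _ _ ((mem_fib _ _).2 hj)⟩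
  have hab : a < b := by
    obtain ⟨k, hk, l, hl, hkl⟩ := Finset.one_lt_card.1 hm
    rw [mem_fib] at hk hl
    have := ha' k hk; have := ha' l hl; have := hb' k hk; have := hb' l hl
    by_contra h
    exact hkl (by omega)
  have hup : Monotone (shift {b} 1 q) := by
    intro i j hij
    have h1 := hq.1 hij
    have h2 := hb' j
    unfold shift
    simp only [Finset.mem_singleton]
    split_ifs with h3 h4 h4
    · omega
    · subst h3
      have : q j ≠ x := fun h => h4 (le_antisymm (h2 h) hij)
      omega
    · omega
    · omega
  have hdown : Monotone (shift {a} (-1) q) := by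
    intro i j hij
    have h1 := hq.1 hij
    have h2 := ha' i
    unfold shift
    simp only [Finset.mem_singleton]
    split_ifs with h3 h4 h4
    · omega
    · omega
    · subst h4
      have : q i ≠ x := fun h => h3 (le_antisymm hij (h2 h))
      omega
    · omega
  have h1 := hq.zero_le_upSlope hΦ hup
  have h2 := hq.upSlope_le_kinks hΦ hdown
  rw [upSlope_singleton] at h1 h2
  rw [kinks_singleton] at h2
  simp only [ha, hb] at h1 h2
  have h3 := add_four_le_of_lt hz hab
  have h4 := hF x
  have h5 : ∑ j, (if a < j ∧ q j - x = e then (1 : ℤ) else 0) ≤ (fib x).card :=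
    (Finset.sum_le_sum fun j _ => by split_ifs <;> omega).trans (hfib (x + e))
  have h6 : ∑ j, (if j < a ∧ x - q j = e then (1 : ℤ) else 0) ≤ (fib x).card :=
    (Finset.sum_le_sum fun j _ => by split_ifs <;> omega).trans (hfib (x - e))
  have key : ∀ d, q d = x → ∑ j, (if q j = x ∧ j ≠ d then (1 : ℤ) else 0) = (fib x).card - 1 := by
    intro d hd
    rw [← Finset.sum_filter, Finset.sum_const, nsmul_eq_mul, mul_one,
      show (Finset.univ.filter fun j => q j = x ∧ j ≠ d) = (fib x).erase d by
        ext j; simp [mem_fib, and_comm],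
      Finset.card_erase_of_mem ((mem_fib _ _).2 hd), Nat.cast_sub (by omega), Nat.cast_one]
  have h7 : ∑ j, (if b < j ∧ q j - x ≤ e then (1 : ℤ) else 0)
      + ∑ j, (if q j = x ∧ j ≠ a then (1 : ℤ) else 0)
      ≤ ∑ j, (if a < j ∧ q j - x ≤ e then (1 : ℤ) else 0) := by
    rw [← Finset.sum_add_distrib]
    refine Finset.sum_le_sum fun j _ => ?_
    have := ha' j; have := hb' j
    split_ifs <;> omega
  have h8 : ∑ j, (if j < a ∧ x - q j < e then (1 : ℤ) else 0)
      + ∑ j, (if q j = x ∧ j ≠ b then (1 : ℤ) else 0)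
      ≤ ∑ j, (if j < b ∧ x - q j < e then (1 : ℤ) else 0) := by
    rw [← Finset.sum_add_distrib]
    refine Finset.sum_le_sum fun j _ => ?_
    have := ha' j; have := hb' j
    split_ifs <;> omega
  rw [key a ha] at h7
  rw [key b hb] at h8
  have : (2 : ℤ) ≤ (fib x).card := by exact_mod_cast hm
  linarith

theorem monotone_shift {q : Fin w → ℤ} (hq : StrictMono q) (C : Finset (Fin w)) {δ : ℤ}
    (hδ : δ = 1 ∨ δ = -1) : Monotone (shift C δ q) := by
  intro i j hij
  unfold shift
  rcases hij.eq_or_lt with rfl | h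
  · exact le_rfl
  · have := hq h
    split_ifs <;> omega

/-- Without kinks the energies of the two shifts average to that of `q`, so minimality makes all
three equal. -/
theorem IsGroundState.shift_of_kinks_eq_zero {e : ℤ} {Φ F : ℤ → ℤ}
    (hΦ : ∀ x, Φ (x + 1) - Φ x = F x) {z q : Fin w → ℤ} (hq : IsGroundState e Φ z q)
    (hq' : StrictMono q) {C : Finset (Fin w)} (hC : kinks e F q C = 0) {δ : ℤ}
    (hδ : δ = 1 ∨ δ = -1) : IsGroundState e Φ z (shift C δ q) := by
  refine ⟨monotone_shift hq' C hδ, fun p hp => le_trans (le_of_eq ?_) (hq.2 p hp)⟩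
  have h1 := hq.zero_le_upSlope hΦ (monotone_shift hq' C (Or.inl rfl))
  have h2 := hq.upSlope_le_kinks hΦ (monotone_shift hq' C (Or.inr rfl))
  have h3 := energy_shift_one (e := e) hΦ z q C
  have h4 := energy_shift_neg_one (e := e) hΦ z q C
  rcases hδ with rfl | rfl <;> linarith

/-- The number of jumps of `F` at particles plus the number of pairs at distance exactly `e`. -/
def tightness (e : ℤ) (F : ℤ → ℤ) (q : Fin w → ℤ) : ℤ :=
  ∑ i, (F (q i) - F (q i - 1)) + ∑ i, ∑ j, if i < j ∧ q j - q i = e then 1 else 0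

theorem kinks_eq_zero_iff {e : ℤ} {F : ℤ → ℤ} (hF : ∀ x, 0 ≤ F x - F (x - 1)) {q : Fin w → ℤ}
    {C : Finset (Fin w)} : kinks e F q C = 0 ↔ (∀ i ∈ C, F (q i) - F (q i - 1) = 0) ∧
      ∀ i j, ¬(i < j ∧ q j - q i = e ∧ ¬(i ∈ C ↔ j ∈ C)) := by
  have h1 : ∀ i ∈ C, 0 ≤ F (q i) - F (q i - 1) := fun i _ => hF _
  have h0 : ∀ i, ∀ j ∈ (Finset.univ : Finset (Fin w)),
      0 ≤ if i < j ∧ q j - q i = e ∧ ¬(i ∈ C ↔ j ∈ C) then (1 : ℤ) else 0 := fun i j _ => by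
    split_ifs <;> simp
  have h2 : ∀ i ∈ (Finset.univ : Finset (Fin w)), 0 ≤ ∑ j : Fin w,
      if i < j ∧ q j - q i = e ∧ ¬(i ∈ C ↔ j ∈ C) then (1 : ℤ) else 0 := fun i _ =>
    Finset.sum_nonneg (h0 i)
  unfold kinks
  rw [add_eq_zero_iff_of_nonneg (Finset.sum_nonneg h1) (Finset.sum_nonneg h2),
    Finset.sum_eq_zero_iff_of_nonneg h1, Finset.sum_eq_zero_iff_of_nonneg h2]
  refine and_congr_right fun _ => forall_congr' fun i => ?_
  rw [Finset.sum_eq_zero_iff_of_nonneg (h0 i)]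
  simp

theorem kinks_nonneg {e : ℤ} {F : ℤ → ℤ} (hF : ∀ x, 0 ≤ F x - F (x - 1)) (q : Fin w → ℤ)
    (C : Finset (Fin w)) : 0 ≤ kinks e F q C :=
  add_nonneg (Finset.sum_nonneg fun i _ => hF _)
    (Finset.sum_nonneg fun i _ => Finset.sum_nonneg fun j _ => by split_ifs <;> simp)

/-- A set without kinks has no jump and no separated pair to lose, so the tightness only gains the
kinks met at the new position. -/
theorem tightness_shift {e : ℤ} {F : ℤ → ℤ} (hF : ∀ x, 0 ≤ F x - F (x - 1)) {q : Fin w → ℤ}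
    {C : Finset (Fin w)} (hC : kinks e F q C = 0) (δ : ℤ) :
    tightness e F (shift C δ q) = tightness e F q + kinks e F (shift C δ q) C := by
  obtain ⟨h4, h6⟩ := (kinks_eq_zero_iff hF).1 hC
  unfold tightness kinks
  rw [add_add_add_comm,
    show ∑ i ∈ C, (F (shift C δ q i) - F (shift C δ q i - 1))
      = ∑ i, if i ∈ C then F (shift C δ q i) - F (shift C δ q i - 1) else 0 by
        simp [Finset.sum_ite_mem]]
  refine congrArg₂ (· + ·) ?_ ?_
  · rw [← Finset.sum_add_distrib]
    refine Finset.sum_congr rfl fun i _ => ?_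
    by_cases hi : i ∈ C
    · rw [h4 i hi, if_pos hi, zero_add]
    · simp [shift, hi]
  · rw [← Finset.sum_add_distrib]
    refine Finset.sum_congr rfl fun i _ => ?_
    rw [← Finset.sum_add_distrib]
    refine Finset.sum_congr rfl fun j _ => ?_
    have := h6 i j
    unfold shift
    by_cases hi : i ∈ C <;> by_cases hj : j ∈ C <;> simp_all

theorem tightness_le {e : ℤ} {F : ℤ → ℤ} (hF : ∀ x, F x - F (x - 1) ≤ 1) (q : Fin w → ℤ) :
    tightness e F q ≤ w + w * w := by
  have h1 : ∑ i, (F (q i) - F (q i - 1)) ≤ ∑ _i : Fin w, (1 : ℤ) :=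
    Finset.sum_le_sum fun i _ => hF _
  have h2 : ∑ i : Fin w, ∑ j : Fin w, (if i < j ∧ q j - q i = e then (1 : ℤ) else 0)
      ≤ ∑ _i : Fin w, ∑ _j : Fin w, (1 : ℤ) :=
    Finset.sum_le_sum fun i _ => Finset.sum_le_sum fun j _ => by split_ifs <;> simp
  simp only [Finset.sum_const, Finset.card_univ, Fintype.card_fin, nsmul_eq_mul, mul_one] at h1 h2
  exact add_le_add h1 h2

/-- There is a strictly increasing ground state no part of which can be moved freely. -/
theorem exists_rigid_isGroundState {e : ℤ} (he : 0 < e) {Φ F : ℤ → ℤ}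
    (hΦ : ∀ x, Φ (x + 1) - Φ x = F x) {lo hi : ℤ} (hlo : ∀ x, x < lo → F x = 0)
    (hhi : ∀ x, hi ≤ x → F x = e) (hF0 : ∀ x, 0 ≤ F x - F (x - 1))
    (hF1 : ∀ x, F x - F (x - 1) ≤ 1) {z : Fin w → ℤ} (hz : ∀ i, 0 ≤ z i ∧ z i ≤ e)
    (hz4 : ∀ i j : Fin w, (j : ℕ) = (i : ℕ) + 1 → 4 ≤ z j - z i) :
    ∃ q, StrictMono q ∧ IsGroundState e Φ z q ∧ ∀ C, kinks e F q C = 0 → C = ∅ := by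
  -- A jump of `F`, which exists because `F` goes from 0 to `e > 0`; it is the target towards which
  -- loose sets are pushed.
  obtain ⟨d, hd⟩ : ∃ d, F d - F (d - 1) ≠ 0 := by
    by_contra! h
    have : ∀ y, lo - 1 ≤ y → F y = 0 := by
      intro y hy
      induction y, hy using Int.leInduction with
      | base => exact hlo _ (by omega)
      | succ n hn ih =>
        have := h (n + 1)
        rw [add_sub_cancel_right] at this
        omega
    have h1 := this (max hi (lo - 1)) (le_max_right _ _)
    rw [hhi _ (le_max_left _ _)] at h1
    omega
  obtain ⟨p, hp⟩ := exists_isGroundState hΦ hlo hhi hz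
  obtain ⟨t, ⟨q, hq, hqt⟩, ht⟩ := Int.exists_greatest_of_bdd
    (P := fun t => ∃ q, IsGroundState e Φ z q ∧ tightness e F q = t)
    ⟨_, by rintro t ⟨q, -, rfl⟩; exact tightness_le hF1 q⟩ ⟨_, p, hp, rfl⟩
  -- Push `C` one step so that particle `i` approaches `d`. Tightness is already maximal, so no kink
  -- appears and the push can be repeated, until `i` sits on the jump `d`: a contradiction.
  have key : ∀ n : ℕ, ∀ q C i, IsGroundState e Φ z q → tightness e F q = t →
      kinks e F q C = 0 → i ∈ C → (q i - d).natAbs = n → False := by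
    intro n
    induction n with
    | zero =>
      intro q C i _ _ hC hi hn
      have := ((kinks_eq_zero_iff hF0).1 hC).1 i hi
      rw [show q i = d by omega] at this
      exact hd this
    | succ n ih =>
      intro q C i hq hqt hC hi hn
      obtain ⟨δ, hδ, hδn⟩ : ∃ δ : ℤ, (δ = 1 ∨ δ = -1) ∧ (q i + δ - d).natAbs = n := by
        rcases le_total (q i) d with h | h
        · exact ⟨1, Or.inl rfl, by omega⟩
        · exact ⟨-1, Or.inr rfl, by omega⟩
      have h1 := hq.shift_of_kinks_eq_zero hΦ (hq.strictMono he hΦ hF1 hz4) hC hδ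
      have h2 := tightness_shift hF0 hC δ
      have h3 := kinks_nonneg (e := e) hF0 (shift C δ q) C
      have h4 := ht _ ⟨_, h1, rfl⟩
      exact ih _ C i h1 (by omega) (by omega) hi (by simpa [shift, hi] using hδn)
  refine ⟨q, hq.strictMono he hΦ hF1 hz4, hq, fun C hC => ?_⟩
  by_contra hne
  obtain ⟨i, hi⟩ := Finset.nonempty_iff_ne_empty.2 hne
  exact key _ q C i hq hqt hC hi rfl

end Energy

/-! ### Anchored configurations -/

section Anchored

variable {w : ℕ}

theorem le_sub_of_modEq_of_lt {e x y : ℤ} (h : x ≡ y [ZMOD e]) (hxy : x < y) : x ≤ y - e := by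
  have := Int.le_of_dvd (by omega) h.dvd
  omega

theorem modEq_sub_self (e x : ℤ) : x - e ≡ x [ZMOD e] := by
  rw [Int.modEq_iff_dvd]
  exact ⟨1, by ring⟩

theorem modEq_add_self (e x : ℤ) : x + e ≡ x [ZMOD e] := by
  rw [Int.modEq_iff_dvd]
  exact ⟨-1, by ring⟩

theorem mem_of_le_of_modEq {e : ℤ} (he : 0 < e) {T : Set ℤ} (hT : ∀ x ∈ T, x - e ∈ T) {x y : ℤ}
    (hy : y ∈ T) (hxy : x ≤ y) (h : x ≡ y [ZMOD e]) : x ∈ T := by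
  have key : ∀ n : ℕ, y - e * n ∈ T := by
    intro n
    induction n with
    | zero => simpa using hy
    | succ n ih =>
      have := hT _ ih
      rwa [show y - e * (n + 1 : ℕ) = y - e * n - e by push_cast; ring]
  obtain ⟨k, hk⟩ := h.dvd
  have h0 : 0 ≤ k := by
    by_contra hneg
    have : e * k < 0 := mul_neg_of_pos_of_neg he (by omega)
    omega
  lift k to ℕ using h0
  have := key k
  rwa [← hk, sub_sub_cancel] at this

/-- On each runner, `Q` is an interval which is empty or contains the first position not
in `T`. -/
structure IsAnchored (e : ℤ) (T Q : Set ℤ) : Prop where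
  up : ∀ x ∈ Q, ∀ y, y ≡ x [ZMOD e] → x < y → y - e ∈ T → y ∈ Q
  down : ∀ x ∈ Q, ∀ y, y ≡ x [ZMOD e] → y < x → y ∉ T → y ∈ Q

open scoped Classical in
-- Call a particle bad if there is a hole in `Q` on its way to the first gap of `T`, that gap
-- included. Particles at distance `e` are bad together, and no bad particle sits on a jump of `F`,
-- since the jumps are the first gaps. The bad particles thus have no kinks, and rigidity leaves
-- none.
theorem isAnchored_of_rigid {e : ℤ} (he : 0 < e) {T : Set ℤ} (hT : ∀ x ∈ T, x - e ∈ T)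
    {F : ℤ → ℤ} (hF : ∀ x, F x - F (x - 1) = if x ∉ T ∧ x - e ∈ T then 1 else 0)
    {q : Fin w → ℤ} (hq : ∀ C, kinks e F q C = 0 → C = ∅) : IsAnchored e T (Set.range q) := by
  let bad : ℤ → Prop := fun x =>
    (x ∈ T ∧ ∃ y, y ∉ Set.range q ∧ y ≡ x [ZMOD e] ∧ x < y ∧ y - e ∈ T) ∨
    (x ∉ T ∧ ∃ y, y ∉ Set.range q ∧ y ≡ x [ZMOD e] ∧ y < x ∧ y ∉ T)
  have hmod : ∀ {x y}, y ≡ x [ZMOD e] → y ≡ x + e [ZMOD e] := fun h =>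
    h.trans (modEq_add_self e _).symm
  have hmod' : ∀ {x y}, y ≡ x + e [ZMOD e] → y ≡ x [ZMOD e] := fun h =>
    h.trans (modEq_add_self e _)
  have hbad : ∀ i j, q j = q i + e → (bad (q i) ↔ bad (q j)) := by
    intro i j hij
    constructor
    · rintro (⟨h1, y, hy, hyx, hlt, hyT⟩ | ⟨h1, y, hy, hyx, hlt, hyT⟩)
      · have hle := le_sub_of_modEq_of_lt hyx.symm hlt
        have hne : y ≠ q j := fun h => hy ⟨j, h.symm⟩
        have h2 := le_sub_of_modEq_of_lt (hij ▸ hmod hyx).symm (by omega)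
        exact Or.inl ⟨mem_of_le_of_modEq he hT hyT h2 ((hij ▸ hmod hyx).symm.trans
          (modEq_sub_self e y).symm), y, hy, hij ▸ hmod hyx, by omega, hyT⟩
      · refine Or.inr ⟨fun h => h1 (mem_of_le_of_modEq he hT h (by omega) ?_), y, hy,
          hij ▸ hmod hyx, by omega, hyT⟩
        rw [hij]; exact (modEq_add_self e _).symm
    · rintro (⟨h1, y, hy, hyx, hlt, hyT⟩ | ⟨h1, y, hy, hyx, hlt, hyT⟩)
      · refine Or.inl ⟨mem_of_le_of_modEq he hT h1 (by omega) ?_, y, hy, hmod' (hij ▸ hyx),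
          by omega, hyT⟩
        rw [hij]; exact (modEq_add_self e _).symm
      · have hle := le_sub_of_modEq_of_lt hyx hlt
        have hne : y ≠ q i := fun h => hy ⟨i, h.symm⟩
        have hyx' := hmod' (hij ▸ hyx)
        exact Or.inr ⟨fun h => hyT (mem_of_le_of_modEq he hT h (by omega) hyx'), y, hy, hyx',
          by omega, hyT⟩
  have hnone := hq (Finset.univ.filter fun i => bad (q i)) (by
    refine (kinks_eq_zero_iff fun x => by rw [hF]; split_ifs <;> simp).2 ⟨?_, ?_⟩
    · intro i hi
      rw [hF, if_neg]
      rintro ⟨h1, h2⟩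
      rcases (Finset.mem_filter.1 hi).2 with h | ⟨-, y, hy, hyx, hlt, hyT⟩
      · exact h1 h.1
      · exact hyT (mem_of_le_of_modEq he hT h2 (le_sub_of_modEq_of_lt hyx hlt)
          (hyx.trans (modEq_sub_self e _).symm))
    · rintro i j ⟨-, hij, hC⟩
      apply hC
      simp only [Finset.mem_filter, Finset.mem_univ, true_and]
      exact hbad i j (by omega))
  have hgood : ∀ i, ¬ bad (q i) := fun i hi => by
    have : i ∈ (∅ : Finset (Fin w)) := hnone ▸ Finset.mem_filter.2 ⟨Finset.mem_univ i, hi⟩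
    simp at this
  constructor
  · rintro _ ⟨i, rfl⟩ y hyx hlt hyT
    by_contra hy
    exact hgood i (Or.inl ⟨mem_of_le_of_modEq he hT hyT (le_sub_of_modEq_of_lt hyx.symm hlt)
      (hyx.symm.trans (modEq_sub_self e y).symm), y, hy, hyx, hlt, hyT⟩)
  · rintro _ ⟨i, rfl⟩ y hyx hlt hyT
    by_contra hy
    exact hgood i (Or.inr ⟨fun h => hyT (mem_of_le_of_modEq he hT h hlt.le hyx),
      y, hy, hyx, hlt, hyT⟩)

/-- The runner of an anchored configuration is a path, rooted at the first position not in `T`;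
these are the descendants of `i`. -/
def IsDescendant (e : ℤ) (T : Set ℤ) (q : Fin w → ℤ) (i j : Fin w) : Prop :=
  q j ≡ q i [ZMOD e] ∧ (q i ∈ T → q j ≤ q i) ∧ (q i - e ∉ T → q i ≤ q j)

/-- `j` is a child of `i`. -/
def IsChild (e : ℤ) (T : Set ℤ) (q : Fin w → ℤ) (i j : Fin w) : Prop :=
  (q j ∈ T ∧ q i = q j + e) ∨ (q j - e ∉ T ∧ q i = q j - e)

theorem sum_ite_eq_one_of_unique {p : Fin w → Prop} [DecidablePred p]
    (k : Fin w) (hk : p k)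
    (h : ∀ j, p j → j = k) : ∑ j, (if p j then (1 : ℤ) else 0) = 1 := by
  rw [Finset.sum_eq_single k fun j _ hj => if_neg fun hp => hj (h j hp)]
  · exact if_pos hk
  · simp

theorem sum_ite_eq_zero_of_forall_not {p : Fin w → Prop} [DecidablePred p]
    (h : ∀ j, ¬ p j) :
    ∑ j, (if p j then (1 : ℤ) else 0) = 0 :=
  Finset.sum_eq_zero fun j _ => if_neg (h j)

theorem sum_ite_le_one_of_subsingleton {p : Fin w → Prop} [DecidablePred p]
    (h : ∀ j k, p j → p k → j = k) :
    ∑ j, (if p j then (1 : ℤ) else 0) ≤ 1 := by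
  by_cases hp : ∃ k, p k
  · obtain ⟨k, hk⟩ := hp
    exact (sum_ite_eq_one_of_unique k hk fun j hj => h j k hj hk).le
  · rw [sum_ite_eq_zero_of_forall_not fun j hj => hp ⟨j, hj⟩]
    exact zero_le_one

end Anchored

/-! ### Subtrees of a runner and the coefficients they determine -/

section Tree

variable {w : ℕ}

open scoped Classical in
-- Edges are one fewer than vertices: each descendant other than `i` is matched with the edge to its
-- parent.
theorem sum_adjacent_descendants {e : ℤ} (he : 0 < e) {T : Set ℤ} (hT : ∀ x ∈ T, x - e ∈ T)
    {q : Fin w → ℤ} (hq : StrictMono q) (hQ : IsAnchored e T (Set.range q)) (i : Fin w) :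
    ∑ j, ∑ k, (if j < k ∧ IsDescendant e T q i j ∧ IsDescendant e T q i k ∧ q k - q j = e
      then (1 : ℤ) else 0) = ∑ j, if IsDescendant e T q i j ∧ j ≠ i then 1 else 0 := by
  have hsplit : ∀ j k : Fin w,
      (if j < k ∧ IsDescendant e T q i j ∧ IsDescendant e T q i k ∧ q k - q j = e
        then (1 : ℤ) else 0) =
      (if IsDescendant e T q i j ∧ IsDescendant e T q i k ∧ q k - q j = e ∧ q j ∈ T
        then (1 : ℤ) else 0) +
      (if IsDescendant e T q i j ∧ IsDescendant e T q i k ∧ q k - q j = e ∧ q j ∉ T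
        then (1 : ℤ) else 0) := by
    intro j k
    have : q k - q j = e → j < k := fun h => hq.lt_iff_lt.1 (by omega)
    by_cases h1 : q j ∈ T <;> by_cases h2 : q k - q j = e <;> simp_all
  simp only [hsplit, Finset.sum_add_distrib]
  -- The child is the lower end of an edge when that end is in `T`, and the upper end otherwise.
  -- Swapping the second sum makes the outer index the child in both.
  rw [Finset.sum_comm (f := fun j k : Fin w =>
    if IsDescendant e T q i j ∧ IsDescendant e T q i k ∧ q k - q j = e ∧ q j ∉ T
        then (1 : ℤ) else 0), ← Finset.sum_add_distrib]
  refine Finset.sum_congr rfl fun j _ => ?_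
  by_cases hj : IsDescendant e T q i j
  swap
  · simp [hj]
  by_cases hji : j = i
  · subst hji
    rw [if_neg fun h => h.2 rfl, sum_ite_eq_zero_of_forall_not, sum_ite_eq_zero_of_forall_not,
      add_zero]
    · rintro k ⟨h1, -, h2, h3⟩
      have := h1.2.2 (by rwa [← h2, sub_sub_cancel])
      omega
    · rintro k ⟨-, h1, h2, h3⟩
      have := h1.2.1 h3
      omega
  rw [if_pos ⟨hj, hji⟩]
  have hne : q j ≠ q i := fun h => hji (hq.injective h)
  by_cases hjT : q j ∈ T
  · have hlt : q j < q i := by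
      by_contra hcon
      have := le_sub_of_modEq_of_lt hj.1.symm (lt_of_le_of_ne (not_lt.1 hcon) hne.symm)
      by_cases hi : q i ∈ T
      · have := hj.2.1 hi
        omega
      · exact hi (mem_of_le_of_modEq he hT hjT (by omega) hj.1.symm)
    have hle := le_sub_of_modEq_of_lt hj.1 hlt
    obtain ⟨k, hk⟩ : q j + e ∈ Set.range q :=
      hQ.up _ ⟨j, rfl⟩ _ (modEq_add_self e _) (by omega) (by simpa using hjT)
    have hkd : IsDescendant e T q i k := by
      refine ⟨?_, fun _ => by omega, fun h => ?_⟩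
      · rw [hk]; exact (modEq_add_self e _).trans hj.1
      · have := hj.2.2 h; omega
    rw [sum_ite_eq_one_of_unique k ⟨hj, hkd, by omega, hjT⟩, sum_ite_eq_zero_of_forall_not,
      add_zero]
    · rintro l ⟨-, -, h2, h3⟩
      apply h3
      rw [show q l = q j - e by omega]
      exact hT _ hjT
    · rintro l ⟨-, -, h2, -⟩
      exact hq.injective (by omega)
  · have hiT : q i ∉ T := fun hi =>
      hjT (mem_of_le_of_modEq he hT hi (hj.2.1 hi) hj.1)
    have hlt : q i < q j := by
      by_contra hcon
      have hlt : q j < q i := lt_of_le_of_ne (not_lt.1 hcon) hne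
      have := le_sub_of_modEq_of_lt hj.1 hlt
      by_cases hi : q i - e ∈ T
      · exact hjT (mem_of_le_of_modEq he hT hi this (hj.1.trans (modEq_sub_self e _).symm))
      · have := hj.2.2 hi
        omega
    have hle := le_sub_of_modEq_of_lt hj.1.symm hlt
    have hjeT : q j - e ∉ T := fun h => hiT (mem_of_le_of_modEq he hT h hle
      (hj.1.symm.trans (modEq_sub_self e _).symm))
    obtain ⟨k, hk⟩ : q j - e ∈ Set.range q :=
      hQ.down _ ⟨j, rfl⟩ _ (modEq_sub_self e _) (by omega) hjeT
    have hkd : IsDescendant e T q i k := by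
      refine ⟨?_, fun h => absurd h hiT, fun h => by omega⟩
      rw [hk]; exact (modEq_sub_self e _).trans hj.1
    rw [sum_ite_eq_zero_of_forall_not, sum_ite_eq_one_of_unique k ⟨hkd, hj, by omega, hk ▸ hjeT⟩,
      zero_add]
    · rintro l ⟨-, -, h2, -⟩
      exact hq.injective (by omega)
    · rintro l ⟨-, -, -, h2⟩
      exact hjT h2

open scoped Classical in
-- If `i` is at the first gap, its descendants are the whole runner and the only kink is the jump at
-- `i`. Otherwise they meet no jump, and only an edge from `i` to its parent can be cut.
theorem kinks_descendants_le_one {e : ℤ} (he : 0 < e) {T : Set ℤ} (hT : ∀ x ∈ T, x - e ∈ T)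
    {F : ℤ → ℤ} (hF : ∀ x, F x - F (x - 1) = if x ∉ T ∧ x - e ∈ T then 1 else 0)
    {q : Fin w → ℤ} (hq : StrictMono q) (i : Fin w) :
    kinks e F q (Finset.univ.filter fun j => IsDescendant e T q i j) ≤ 1 := by
  unfold kinks
  simp only [hF, Finset.sum_filter, Finset.mem_filter, Finset.mem_univ, true_and]
  have hmod : ∀ j k, q k - q j = e → (q k ≡ q i [ZMOD e] ↔ q j ≡ q i [ZMOD e]) := by
    intro j k h
    have : q k ≡ q j [ZMOD e] := by
      rw [show q k = q j + e by omega]; exact modEq_add_self e _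
    exact ⟨this.symm.trans, this.trans⟩
  by_cases hroot : q i ∉ T ∧ q i - e ∈ T
  · have h1 : ∀ j k, ¬(j < k ∧ q k - q j = e ∧
        ¬(IsDescendant e T q i j ↔ IsDescendant e T q i k)) := by
      rintro j k ⟨-, h1, h2⟩
      apply h2
      simp only [IsDescendant, hroot, hmod j k h1, false_imp_iff, not_true, and_true]
    simp only [h1, if_false, Finset.sum_const_zero, add_zero, ← ite_and]
    refine sum_ite_le_one_of_subsingleton fun j k hj hk => ?_
    have key : ∀ l, IsDescendant e T q i l ∧ q l ∉ T ∧ q l - e ∈ T → q l = q i := by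
      rintro l ⟨h1, h2, h3⟩
      rcases lt_trichotomy (q l) (q i) with h | h | h
      · exact absurd (mem_of_le_of_modEq he hT hroot.2 (le_sub_of_modEq_of_lt h1.1 h)
          (h1.1.trans (modEq_sub_self e _).symm)) h2
      · exact h
      · exact absurd (mem_of_le_of_modEq he hT h3 (le_sub_of_modEq_of_lt h1.1.symm h)
          (h1.1.symm.trans (modEq_sub_self e _).symm)) hroot.1
    exact hq.injective ((key j hj).trans (key k hk).symm)
  · have h1 : ∀ j, ¬(IsDescendant e T q i j ∧ q j ∉ T ∧ q j - e ∈ T) := by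
      rintro j ⟨h1, h2, h3⟩
      by_cases hi : q i ∈ T
      · exact h2 (mem_of_le_of_modEq he hT hi (h1.2.1 hi) h1.1)
      · have hi' : q i - e ∉ T := fun h => hroot ⟨hi, h⟩
        exact hi' (mem_of_le_of_modEq he hT h3 (by have := h1.2.2 hi'; omega)
          ((modEq_sub_self e _).trans (h1.1.symm.trans (modEq_sub_self e _).symm)))
    simp only [← ite_and, h1, if_false, Finset.sum_const_zero, zero_add]
    by_cases hi : q i ∈ T
    · have hi' : q i - e ∈ T := hT _ hi
      have h2 : ∀ j k, (j < k ∧ q k - q j = e ∧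
          ¬(IsDescendant e T q i j ↔ IsDescendant e T q i k)) → j = i ∧ q k = q i + e := by
        rintro j k ⟨-, h2, h3⟩
        simp only [IsDescendant, hi, hi', hmod j k h2, not_true, false_imp_iff, and_true,
          true_imp_iff] at h3
        have h4 : q j ≡ q i [ZMOD e] ∧ q j ≤ q i ∧ q i < q k := by
          by_contra hcon
          apply h3
          constructor
          · rintro ⟨h5, h6⟩
            exact ⟨h5, not_lt.1 fun h7 => hcon ⟨h5, h6, h7⟩⟩
          · rintro ⟨h5, h6⟩
            exact ⟨h5, by omega⟩
        have h5 : q j = q i := by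
          by_contra hne
          have := le_sub_of_modEq_of_lt h4.1 (lt_of_le_of_ne h4.2.1 hne)
          omega
        exact ⟨hq.injective h5, by omega⟩
      have h3 : ∀ j, ∑ k, (if j < k ∧ q k - q j = e ∧
          ¬(IsDescendant e T q i j ↔ IsDescendant e T q i k) then (1 : ℤ) else 0)
          ≤ if j = i then 1 else 0 := by
        intro j
        split_ifs with hj
        · exact sum_ite_le_one_of_subsingleton fun k l hk hl =>
            hq.injective ((h2 j k hk).2.trans (h2 j l hl).2.symm)
        · exact (sum_ite_eq_zero_of_forall_not fun k hk => hj (h2 j k hk).1).le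
      exact (Finset.sum_le_sum fun j _ => h3 j).trans
        (sum_ite_le_one_of_subsingleton fun j k hj hk => hj.trans hk.symm)
    · have hi' : q i - e ∉ T := fun h => hroot ⟨hi, h⟩
      have h2 : ∀ j k, (j < k ∧ q k - q j = e ∧
          ¬(IsDescendant e T q i j ↔ IsDescendant e T q i k)) → k = i ∧ q j = q i - e := by
        rintro j k ⟨-, h2, h3⟩
        simp only [IsDescendant, hi, hi', hmod j k h2, not_false_iff, false_imp_iff, true_and,
          true_imp_iff] at h3
        have h4 : q k ≡ q i [ZMOD e] ∧ q j < q i ∧ q i ≤ q k := by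
          by_contra hcon
          apply h3
          constructor
          · rintro ⟨h5, h6⟩
            exact ⟨h5, by omega⟩
          · rintro ⟨h5, h6⟩
            exact ⟨h5, not_lt.1 fun h7 => hcon ⟨(hmod j k h2).2 h5, h7, h6⟩⟩
        have h5 : q i = q k := by
          by_contra hne
          have := le_sub_of_modEq_of_lt h4.1.symm (lt_of_le_of_ne h4.2.2 hne)
          omega
        exact ⟨hq.injective h5.symm, by omega⟩
      rw [Finset.sum_comm]
      have h3 : ∀ k, ∑ j, (if j < k ∧ q k - q j = e ∧
          ¬(IsDescendant e T q i j ↔ IsDescendant e T q i k) then (1 : ℤ) else 0)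
          ≤ if k = i then 1 else 0 := by
        intro k
        split_ifs with hk
        · exact sum_ite_le_one_of_subsingleton fun j l hj hl =>
            hq.injective ((h2 j k hj).2.trans (h2 l k hl).2.symm)
        · exact (sum_ite_eq_zero_of_forall_not fun j hj => hk (h2 j k hj).1).le
      exact (Finset.sum_le_sum fun j _ => h3 j).trans
        (sum_ite_le_one_of_subsingleton fun j k hj hk => hj.trans hk.symm)

open scoped Classical in
-- The descendants of `i` are `i` and the disjoint subtrees of its children. This recovers a vector
-- from its subtree sums.
theorem indicator_isDescendant {e : ℤ} (he : 0 < e) {T : Set ℤ} (hT : ∀ x ∈ T, x - e ∈ T)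
    {q : Fin w → ℤ} (hq : StrictMono q) (hQ : IsAnchored e T (Set.range q)) (i k : Fin w) :
    (if IsDescendant e T q i k then (1 : ℤ) else 0) =
      (if k = i then 1 else 0) +
        ∑ j, if IsChild e T q i j ∧ IsDescendant e T q j k then 1 else 0 := by
  by_cases hki : k = i
  · subst hki
    rw [if_pos ⟨Int.ModEq.refl _, fun _ => le_rfl, fun _ => le_rfl⟩, if_pos rfl,
      sum_ite_eq_zero_of_forall_not, add_zero]
    rintro j ⟨⟨h1, h2⟩ | ⟨h1, h2⟩, h3⟩
    · have := h3.2.1 h1; omega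
    · have := h3.2.2 h1; omega
  rw [if_neg hki, zero_add]
  by_cases hk : IsDescendant e T q i k
  · rw [if_pos hk]
    rcases lt_or_gt_of_ne fun h => hki (hq.injective h) with hlt | hlt
    · have hle := le_sub_of_modEq_of_lt hk.1 hlt
      have hi' : q i - e ∈ T := by
        by_contra h
        have := hk.2.2 h
        omega
      obtain ⟨j, hj⟩ : q i - e ∈ Set.range q := by
        rcases hle.eq_or_lt with h | h
        · exact ⟨k, h⟩
        · exact hQ.up _ ⟨k, rfl⟩ _ ((modEq_sub_self e _).trans hk.1.symm) h (hT _ hi')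
      rw [sum_ite_eq_one_of_unique j]
      · refine ⟨Or.inl ⟨hj ▸ hi', by omega⟩, ?_, fun _ => by omega, fun h => ?_⟩
        · rw [hj]; exact hk.1.trans (modEq_sub_self e _).symm
        · rw [hj] at h; exact absurd (hT _ hi') h
      · rintro l ⟨⟨h1, h2⟩ | ⟨h1, h2⟩, h3⟩
        · exact hq.injective (by omega)
        · have := h3.2.2 h1; omega
    · have hle := le_sub_of_modEq_of_lt hk.1.symm hlt
      have hi : q i ∉ T := fun h => by
        have := hk.2.1 h
        omega
      have hi' : q i + e ∉ T := fun h => hi (by simpa using hT _ h)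
      obtain ⟨j, hj⟩ : q i + e ∈ Set.range q := by
        rcases hle.eq_or_lt with h | h
        · exact ⟨k, by omega⟩
        · exact hQ.down _ ⟨k, rfl⟩ _ ((modEq_add_self e _).trans hk.1.symm) (by omega) hi'
      rw [sum_ite_eq_one_of_unique j]
      · refine ⟨Or.inr ⟨?_, by omega⟩, ?_, fun h => ?_, fun _ => by omega⟩
        · rwa [hj, add_sub_cancel_right]
        · rw [hj]; exact hk.1.trans (modEq_add_self e _).symm
        · rw [hj] at h; exact absurd h hi'
      · rintro l ⟨⟨h1, h2⟩ | ⟨h1, h2⟩, h3⟩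
        · have := h3.2.1 h1; omega
        · exact hq.injective (by omega)
  · rw [if_neg hk, sum_ite_eq_zero_of_forall_not]
    rintro j ⟨⟨h1, h2⟩ | ⟨h1, h2⟩, h3⟩
    · refine hk ⟨?_, fun _ => ?_, fun h => ?_⟩
      · rw [h2]; exact h3.1.trans (modEq_add_self e _).symm
      · have := h3.2.1 h1; omega
      · rw [h2, add_sub_cancel_right] at h; exact absurd h1 h
    · refine hk ⟨?_, fun h => ?_, fun _ => ?_⟩
      · rw [h2]; exact h3.1.trans (modEq_sub_self e _).symm
      · rw [h2] at h; exact absurd h h1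
      · have := h3.2.2 h1; omega

open scoped Classical in
/-- At an anchored ground state the force decomposes with coefficients `0` and `1`. -/
theorem exists_coefficients {e : ℤ} (he : 0 < e) {T : Set ℤ} (hT : ∀ x ∈ T, x - e ∈ T)
    {Φ F : ℤ → ℤ} (hΦ : ∀ x, Φ (x + 1) - Φ x = F x)
    (hF : ∀ x, F x - F (x - 1) = if x ∉ T ∧ x - e ∈ T then 1 else 0)
    {z q : Fin w → ℤ} (hq : StrictMono q) (hQ : IsAnchored e T (Set.range q))
    (hg : IsGroundState e Φ z q) :
    ∃ Γ : Finset (Fin w), ∀ i,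
      z i - (F (q i) + ∑ j, (if i < j ∧ q j - q i ≤ e then (1 : ℤ) else 0)
        - ∑ j, (if j < i ∧ q i - q j < e then (1 : ℤ) else 0) - 1) =
      (if i ∈ Γ then (1 : ℤ) else 0) - ∑ j, if IsChild e T q i j ∧ j ∈ Γ then (1 : ℤ) else 0 := by
  -- The bracket is the label of the partition to be built, see `zLabel_eq`; the subtree sums `s` of
  -- `y` will be the coefficients.
  set y : Fin w → ℤ := fun i =>
    z i - (F (q i) + ∑ j, (if i < j ∧ q j - q i ≤ e then (1 : ℤ) else 0)
        - ∑ j, (if j < i ∧ q i - q j < e then (1 : ℤ) else 0) - 1) with hy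
  let s : Fin w → ℤ := fun i => ∑ k, if IsDescendant e T q i k then y k else 0
  have hs : ∀ i, s i = 0 ∨ s i = 1 := by
    intro i
    let C := Finset.univ.filter fun j => IsDescendant e T q i j
    have h1 := hg.zero_le_upSlope hΦ (monotone_shift hq C (Or.inl rfl))
    have h2 := (hg.upSlope_le_kinks hΦ (monotone_shift hq C (Or.inr rfl))).trans
      (kinks_descendants_le_one he hT hF hq i)
    -- Each descendant contributes `1 - y j`; subtracting the edges, one fewer than the descendants,
    -- leaves `1 - s i`.
    have h3 : upSlope e F z q C = 1 - s i := by
      rw [upSlope_eq]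
      simp only [C, Finset.mem_filter, Finset.mem_univ, true_and]
      rw [sum_adjacent_descendants he hT hq hQ, Finset.sum_filter, ← Finset.sum_sub_distrib,
        show 1 - s i = ∑ j, ((if j = i then 1 else 0)
          - if IsDescendant e T q i j then y j else 0) by simp [s, Finset.sum_sub_distrib]]
      refine Finset.sum_congr rfl fun j _ => ?_
      by_cases hji : j = i
      · subst hji
        have hd : IsDescendant e T q j j := ⟨Int.ModEq.refl _, fun _ => le_rfl, fun _ => le_rfl⟩
        rw [if_pos hd, if_neg fun h => h.2 rfl, if_pos rfl, if_pos hd, hy]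
        ring
      · by_cases hd : IsDescendant e T q i j
        · rw [if_pos hd, if_pos ⟨hd, hji⟩, if_neg hji, if_pos hd, hy]
          ring
        · rw [if_neg hd, if_neg fun h => hd h.1, if_neg hji, if_neg hd]
    have : 0 ≤ s i ∧ s i ≤ 1 := by constructor <;> linarith
    omega
  have hrec : ∀ i, y i = s i - ∑ j, if IsChild e T q i j then s j else 0 := by
    intro i
    have h1 : ∑ j, (if IsChild e T q i j then s j else 0) =
        ∑ k, (∑ j, if IsChild e T q i j ∧ IsDescendant e T q j k then (1 : ℤ) else 0) * y k := by
      simp only [Finset.sum_mul]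
      rw [Finset.sum_comm]
      refine Finset.sum_congr rfl fun j _ => ?_
      by_cases hj : IsChild e T q i j <;> simp [hj, s]
    have h2 : s i = ∑ k, (if IsDescendant e T q i k then (1 : ℤ) else 0) * y k :=
      Finset.sum_congr rfl fun k _ => by split_ifs <;> simp
    rw [h1, h2, ← Finset.sum_sub_distrib]
    simp only [indicator_isDescendant he hT hq hQ, ← sub_mul, add_sub_cancel_right]
    simp
  refine ⟨Finset.univ.filter fun i => s i = 1, fun i => ?_⟩
  have h1 : ∀ j, (if s j = 1 then (1 : ℤ) else 0) = s j := by
    intro j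
    rcases hs j with h | h <;> simp [h]
  have h2 : ∀ j, (if IsChild e T q i j ∧ s j = 1 then (1 : ℤ) else 0)
      = if IsChild e T q i j then s j else 0 := fun j => by rw [ite_and, h1]
  simp only [Finset.mem_filter, Finset.mem_univ, true_and, h1, h2]
  exact hrec i

end Tree

/-! ### Sets of beta-numbers -/

theorem rowLen_eq_zero {μ : YoungDiagram} {i : ℕ} (hi : μ.colLen 0 ≤ i) : μ.rowLen i = 0 := by
  by_contra h
  have h1 : (i, 0) ∈ μ := YoungDiagram.mem_iff_lt_rowLen.2 (Nat.pos_of_ne_zero h)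
  have h2 := YoungDiagram.mem_iff_lt_colLen.1 h1
  omega

theorem mem_betaSet_of_lt {μ : YoungDiagram} {N : ℕ} (hN : μ.colLen 0 ≤ N) {x : ℤ}
    (hx : x < -N) : x ∈ betaSet μ := by
  refine ⟨(-x - 1).toNat, ?_⟩
  simp only [rowLen_eq_zero (μ := μ) (i := (-x - 1).toNat) (by omega)]
  omega

theorem lt_of_mem_betaSet {μ : YoungDiagram} {x : ℤ} (hx : x ∈ betaSet μ) :
    x < μ.rowLen 0 := by
  obtain ⟨i, rfl⟩ := hx
  have := μ.rowLen_anti 0 i (Nat.zero_le _)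
  simp only
  omega

open scoped Classical in
theorem card_filter_mem_betaSet {μ : YoungDiagram} {N : ℕ} (hN : μ.colLen 0 ≤ N) {M : ℤ}
    (hM : (μ.rowLen 0 : ℤ) ≤ M) :
    ((Finset.Ico (-N : ℤ) M).filter (· ∈ betaSet μ)).card = N := by
  have h : (Finset.Ico (-N : ℤ) M).filter (· ∈ betaSet μ) =
      (Finset.range N).image fun i : ℕ => (μ.rowLen i : ℤ) - ((i : ℤ) + 1) := by
    ext x
    simp only [Finset.mem_filter, Finset.mem_Ico, Finset.mem_image, Finset.mem_range]
    constructor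
    · rintro ⟨⟨h1, -⟩, i, rfl⟩
      refine ⟨i, ?_, rfl⟩
      by_contra hi
      simp only [rowLen_eq_zero (μ := μ) (i := i) (by omega)] at h1
      omega
    · rintro ⟨i, hi, rfl⟩
      have := μ.rowLen_anti 0 i (Nat.zero_le _)
      exact ⟨⟨by omega, by omega⟩, i, rfl⟩
  rw [h, Finset.card_image_of_injective, Finset.card_range]
  intro i j hij
  simp only at hij
  rcases le_total i j with h | h
  · have := μ.rowLen_anti i j h; omega
  · have := μ.rowLen_anti j i h; omega

theorem exists_rowLen_eq {f : ℕ → ℕ} (hf : Antitone f) {N : ℕ} (hN : ∀ i, N ≤ i → f i = 0) :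
    ∃ μ : YoungDiagram, ∀ i, μ.rowLen i = f i := by
  let μ : YoungDiagram :=
    { cells := (Finset.range N ×ˢ Finset.range (f 0)).filter fun c => c.2 < f c.1
      isLowerSet := by
        rintro ⟨a, b⟩ ⟨c, d⟩ ⟨h1, h2⟩ h
        simp only [Finset.coe_filter, Finset.mem_product, Finset.mem_range, Set.mem_ofPred_eq]
          at h ⊢
        simp only at h1 h2
        have := hf h1
        omega }
  refine ⟨μ, fun i => ?_⟩
  have key : ∀ j, j < μ.rowLen i ↔ j < f i := by
    intro j
    rw [← YoungDiagram.mem_iff_lt_rowLen, ← YoungDiagram.mem_cells]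
    simp only [μ, Finset.mem_filter, Finset.mem_product, Finset.mem_range]
    refine ⟨fun h => h.2, fun h => ⟨⟨?_, ?_⟩, h⟩⟩
    · by_contra hi
      have := hN i (by omega)
      omega
    · have := hf (Nat.zero_le i); omega
  exact le_antisymm (not_lt.1 fun h => lt_irrefl _ ((key _).1 h))
    (not_lt.1 fun h => lt_irrefl _ ((key _).2 h))

open scoped Classical in
-- The cardinality condition says that `S` has as many elements `≥ 0` as it has gaps `< 0`, which
-- characterises bead sets among sets full far below and bounded above.
theorem exists_betaSet_eq {S : Set ℤ} {N : ℕ} {M : ℤ} (h1 : ∀ x : ℤ, x < -N → x ∈ S)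
    (h2 : ∀ x ∈ S, x < M) (h3 : ((Finset.Ico (-N : ℤ) M).filter (· ∈ S)).card = N) :
    ∃ μ, betaSet μ = S := by
  set A := (Finset.Ico (-N : ℤ) M).filter (· ∈ S) with hA
  let f := A.orderEmbOfFin h3
  have hmem : ∀ k, -(N : ℤ) ≤ f k ∧ f k ∈ S := fun k => by
    have : f k ∈ A := A.orderEmbOfFin_mem h3 k
    rw [hA, Finset.mem_filter, Finset.mem_Ico] at this
    exact ⟨this.1.1, this.2⟩
  -- This makes the parts nonnegative, so that `toNat` in `g` truncates nothing. There the index is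
  -- reversed because parts decrease.
  have hlow : ∀ k : Fin N, (k : ℤ) - N ≤ f k := by
    rintro ⟨k, hk⟩
    induction k with
    | zero => have := (hmem ⟨0, hk⟩).1; simp only [Nat.cast_zero]; omega
    | succ n ih =>
      have h4 := ih (by omega)
      have h5 : f ⟨n, by omega⟩ < f ⟨n + 1, hk⟩ := f.strictMono (Fin.mk_lt_mk.2 (by omega))
      simp only at h4 ⊢
      push_cast
      omega
  let g : ℕ → ℕ := fun i => if h : i < N then (f ⟨N - 1 - i, by omega⟩ + i + 1).toNat else 0
  have hg : Antitone g := by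
    refine antitone_nat_of_succ_le fun n => ?_
    simp only [g]
    split_ifs with h h' h'
    · have h5 : f ⟨N - 1 - (n + 1), by omega⟩ < f ⟨N - 1 - n, by omega⟩ :=
        f.strictMono (Fin.mk_lt_mk.2 (by omega))
      push_cast
      omega
    · omega
    · exact Nat.zero_le _
    · exact le_rfl
  obtain ⟨μ, hμ⟩ := exists_rowLen_eq hg (N := N) fun i hi => dif_neg (by omega)
  refine ⟨μ, Set.ext fun x => ⟨?_, fun hx => ?_⟩⟩
  · rintro ⟨i, rfl⟩
    simp only [hμ, g]
    split_ifs with h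
    · have h5 := hlow ⟨N - 1 - i, by omega⟩
      simp only at h5
      convert (hmem ⟨N - 1 - i, by omega⟩).2 using 1
      omega
    · exact h1 _ (by omega)
  · by_cases hxN : x < -N
    · refine ⟨(-x - 1).toNat, ?_⟩
      simp only [hμ, g]
      rw [dif_neg (by omega)]
      omega
    · have hxA : x ∈ A := by
        rw [hA, Finset.mem_filter, Finset.mem_Ico]
        exact ⟨⟨by omega, h2 x hx⟩, hx⟩
      have : x ∈ Set.range f := by
        rw [Finset.range_orderEmbOfFin]; exact hxA
      obtain ⟨k, rfl⟩ := this
      refine ⟨N - 1 - k, ?_⟩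
      have hk := k.2
      have h5 := hlow k
      have h6 : (⟨N - 1 - (N - 1 - k), by omega⟩ : Fin N) = k := Fin.ext (by simp only; omega)
      simp only [hμ, g]
      rw [dif_pos (by omega), h6]
      omega

/-! ### Weights -/

theorem finite_wt (e : ℕ) (μ : YoungDiagram) (b : ℤ) :
    {x : ℤ | x < b ∧ x ≡ b [ZMOD (e : ℤ)] ∧ x ∉ betaSet μ}.Finite := by
  refine (Set.finite_Ico (-(μ.colLen 0) : ℤ) b).subset ?_
  rintro x ⟨h1, -, h2⟩
  refine ⟨?_, h1⟩
  by_contra h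
  exact h2 (mem_betaSet_of_lt le_rfl (not_le.1 h))

theorem wt_eq_zero_of_forall {e : ℕ} {μ : YoungDiagram} {b : ℤ}
    (h : ∀ x, x < b → x ≡ b [ZMOD (e : ℤ)] → x ∈ betaSet μ) : wt e μ b = 0 := by
  rw [wt, Set.ncard_eq_zero (finite_wt e μ b)]
  ext x
  simp only [Set.mem_ofPred_eq, Set.mem_empty_iff_false, iff_false]
  rintro ⟨h1, h2, h3⟩
  exact h3 (h x h1 h2)

open scoped Classical in
theorem wt_add_self {e : ℕ} (he : 0 < e) (μ : YoungDiagram) (b : ℤ) :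
    wt e μ (b + e) = wt e μ b + if b ∈ betaSet μ then 0 else 1 := by
  have hset : {x : ℤ | x < b + e ∧ x ≡ b + e [ZMOD (e : ℤ)] ∧ x ∉ betaSet μ} =
      if b ∈ betaSet μ then {x : ℤ | x < b ∧ x ≡ b [ZMOD (e : ℤ)] ∧ x ∉ betaSet μ}
      else insert b {x : ℤ | x < b ∧ x ≡ b [ZMOD (e : ℤ)] ∧ x ∉ betaSet μ} := by
    have key : ∀ x, x ∉ betaSet μ → ((x < b + e ∧ x ≡ b + e [ZMOD (e : ℤ)]) ↔
        x = b ∨ x < b ∧ x ≡ b [ZMOD (e : ℤ)]) := by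
      intro x _
      constructor
      · rintro ⟨h1, h2⟩
        have := le_sub_of_modEq_of_lt h2 h1
        rcases eq_or_ne x b with h | h
        · exact Or.inl h
        · exact Or.inr ⟨by omega, h2.trans (modEq_add_self _ _)⟩
      · rintro (rfl | ⟨h1, h2⟩)
        · exact ⟨by omega, (modEq_add_self _ _).symm⟩
        · exact ⟨by omega, h2.trans (modEq_add_self _ _).symm⟩
    ext x
    by_cases hx : x ∈ betaSet μ
    · split_ifs with hb
      · simp [hx]
      · have : x ≠ b := fun h => hb (h ▸ hx)
        simp [hx, this]
    · have := key x hx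
      split_ifs with hb
      · have hne : x ≠ b := fun h => hx (h ▸ hb)
        simpa [hx, hne] using this
      · simpa [hx] using this
  unfold wt
  rw [hset]
  split_ifs with hb
  · rfl
  · rw [Set.ncard_insert_of_notMem (fun h => lt_irrefl _ h.1) (finite_wt e μ b)]

theorem wt_le_wt_add {e : ℕ} (he : 0 < e) (μ : YoungDiagram) (b : ℤ) (n : ℕ) :
    wt e μ (b + n * e) ≤ wt e μ b + n := by
  induction n with
  | zero => simp
  | succ n ih =>
    rw [show b + ((n + 1 : ℕ) : ℤ) * e = b + n * e + e by push_cast; ring, wt_add_self he]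
    split_ifs <;> omega

theorem sub_mem_slidBeads {e : ℕ} (he : 0 < e) (μ : YoungDiagram) {x : ℤ}
    (hx : x ∈ slidBeads e μ) : x - e ∈ slidBeads e μ := by
  obtain ⟨b, -, rfl⟩ := hx
  -- The claim covers every integer `b`, bead or not: an unoccupied `b - e` has weight one less than
  -- `b`, hence the same slid position, and the induction passes to it.
  have key : ∀ n : ℕ, ∀ b : ℤ, (b + μ.colLen 0).toNat ≤ n →
      b - (wt e μ b : ℤ) * e - e ∈ slidBeads e μ := by
    intro n
    induction n with
    | zero =>
      intro b hb
      refine ⟨b - e, mem_betaSet_of_lt le_rfl (by omega), ?_⟩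
      have h0 : ∀ c : ℤ, c ≤ b → wt e μ c = 0 := fun c hc =>
        wt_eq_zero_of_forall fun x hx _ => mem_betaSet_of_lt le_rfl (by omega)
      simp [h0 b le_rfl, h0 (b - e) (by omega)]
    | succ n ih =>
      intro b hb
      have h := wt_add_self he μ (b - e)
      rw [sub_add_cancel] at h
      by_cases hmem : b - e ∈ betaSet μ
      · rw [if_pos hmem] at h
        exact ⟨b - e, hmem, by simp only [h, add_zero]; ring⟩
      · rw [if_neg hmem] at h
        have := ih (b - e) (by omega)
        rw [h]
        convert this using 1
        push_cast
        ring
  exact key _ b le_rfl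

theorem IsCore.sub_mem {e : ℕ} (he : 0 < e) {κ : YoungDiagram} (hκ : IsCore e κ) {x : ℤ}
    (hx : x ∈ betaSet κ) : x - e ∈ betaSet κ := by
  have h : betaSet κ = slidBeads e κ := hκ
  rw [h] at hx ⊢
  exact sub_mem_slidBeads he κ hx

/-! ### Points of a discrete parallelotope lie in the cube -/

theorem mem_movements {e : ℕ} {μ : YoungDiagram} {p : ℤ ×ₗ ℤ} :
    p ∈ movements e μ ↔ (ofLex p).2 ∈ betaSet μ ∧
      ∃ n < wt e μ (ofLex p).2, (ofLex p).1 = (ofLex p).2 - n * e := by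
  simp only [movements, Finset.mem_image, Finset.mem_sigma, Finset.mem_range, movedBeads,
    Set.Finite.mem_toFinset, Set.mem_ofPred_eq]
  constructor
  · rintro ⟨⟨b, n⟩, ⟨⟨h1, -⟩, h2⟩, rfl⟩
    exact ⟨h1, n, h2, rfl⟩
  · rintro ⟨h1, n, h2, h3⟩
    exact ⟨⟨(ofLex p).2, n⟩, ⟨⟨h1, Nat.zero_lt_of_lt h2⟩, h2⟩, by rw [← h3]; rfl⟩

section

variable {e : ℕ} {μ : YoungDiagram} {w : ℕ} {h : weight e μ = w}

theorem movement_mem (i : Fin w) : movement e μ h i ∈ movements e μ :=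
  Finset.orderEmbOfFin_mem _ _ i

theorem bead_mem (i : Fin w) : bead e μ h i ∈ betaSet μ :=
  (mem_movements.1 (movement_mem i)).1

theorem exists_start_eq (i : Fin w) :
    ∃ n < wt e μ (bead e μ h i), start e μ h i = bead e μ h i - n * e :=
  (mem_movements.1 (movement_mem i)).2

theorem exists_movement_eq {b : ℤ} (hb : b ∈ betaSet μ) {n : ℕ} (hn : n < wt e μ b) :
    ∃ i : Fin w, start e μ h i = b - n * e ∧ bead e μ h i = b := by
  have h1 : toLex (b - n * e, b) ∈ movements e μ := mem_movements.2 ⟨hb, n, hn, rfl⟩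
  have h2 : toLex (b - n * e, b) ∈ Set.range (movement e μ h) := by
    rw [movement, Finset.range_orderEmbOfFin]
    exact h1
  obtain ⟨i, hi⟩ := h2
  exact ⟨i, by rw [start, hi]; rfl, by rw [bead, hi]; rfl⟩

theorem start_mono : Monotone (start e μ h) := by
  intro i j hij
  have := (movement e μ h).monotone hij
  rcases (Prod.Lex.le_iff).1 this with h1 | h1
  · exact h1.le
  · exact h1.1.le

theorem start_le_bead (i : Fin w) : start e μ h i ≤ bead e μ h i := by
  obtain ⟨n, -, hn⟩ := exists_start_eq (h := h) i
  rw [hn]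
  have : (0 : ℤ) ≤ n * e := by positivity
  omega

theorem modifiedBasis_le (i j : Fin w) : modifiedBasis e μ h j i ≤ if j = i then 1 else 0 := by
  have h1 : ∀ a b : Fin w, (Pi.single a 1 - Pi.single b 1 : Fin w → ℤ) i ≤
      if a = i then 1 else 0 := by
    intro a b
    simp only [Pi.sub_apply, Pi.single_apply, eq_comm (a := i)]
    split_ifs <;> simp
  unfold modifiedBasis
  split_ifs with h2 h3
  all_goals first
    | exact (h1 _ _).trans (by simp_all)
    | simp_all [Pi.single_apply, eq_comm]

theorem zLabel_nonneg (i : Fin w) : 0 ≤ zLabel e μ h i := Int.natCast_nonneg _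

theorem sum_modifiedBasis_le_one (Γ : Finset (Fin w)) (i : Fin w) :
    (∑ j ∈ Γ, modifiedBasis e μ h j) i ≤ 1 := by
  rw [Finset.sum_apply]
  refine (Finset.sum_le_sum fun j _ => modifiedBasis_le i j).trans ?_
  rw [Finset.sum_ite_eq']
  split_ifs <;> simp

theorem zLabel_le_of_start_mem {i : Fin w} (he : 0 < e) (hi : start e μ h i ∈ betaSet μ) :
    zLabel e μ h i ≤ e - 1 := by
  have h1 : Set.Ioc (start e μ h i - (e : ℤ)) (start e μ h i) \ betaSet μ ⊆
      ((Finset.Ioo (start e μ h i - (e : ℤ)) (start e μ h i) : Finset ℤ) : Set ℤ) := by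
    rintro x ⟨⟨h1, h2⟩, h3⟩
    rw [Finset.coe_Ioo]
    exact ⟨h1, lt_of_le_of_ne h2 fun h => h3 (h ▸ hi)⟩
  have h2 := Set.ncard_le_ncard h1 (Finset.finite_toSet _)
  rw [Set.ncard_coe_finset, Int.card_Ioo] at h2
  unfold zLabel
  omega

/-- Otherwise the movement of the same bead from its original position would come later. -/
theorem start_mem_of_isMax {i : Fin w} (hi : ∀ j, j ≤ i) : start e μ h i ∈ betaSet μ := by
  obtain ⟨n, hn, -⟩ := exists_start_eq (h := h) i
  obtain ⟨j, hj, -⟩ := exists_movement_eq (h := h) (bead_mem (h := h) i) (n := 0) (by omega)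
  have h1 := start_mono (h := h) (hi j)
  have h2 := start_le_bead (h := h) i
  have h3 : start e μ h i = bead e μ h i := by
    push_cast at hj
    linarith
  rw [h3]
  exact bead_mem i

theorem lastOnRunner_mem_sameRunner (i : Fin w) :
    lastOnRunner e μ h i ∈ sameRunner e μ h i :=
  Finset.max'_mem _ _

theorem le_lastOnRunner {i j : Fin w} (hj : j ∈ sameRunner e μ h i) :
    j ≤ lastOnRunner e μ h i :=
  Finset.le_max' _ _ hj

theorem bead_pivot (i : Fin w) :
    bead e μ h (pivot e μ h i) = bead e μ h (lastOnRunner e μ h i) :=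
  (Finset.mem_filter.1 (Finset.min'_mem _ ⟨_, lastOnRunner_mem e μ h i⟩)).2

theorem pivot_le {i j : Fin w} (hj : j ∈ sameRunner e μ h i)
    (hb : bead e μ h j = bead e μ h (lastOnRunner e μ h i)) : pivot e μ h i ≤ j :=
  Finset.min'_le _ _ (Finset.mem_filter.2 ⟨hj, hb⟩)

theorem mem_sameRunner {i j : Fin w} :
    j ∈ sameRunner e μ h i ↔ start e μ h j ≡ start e μ h i [ZMOD (e : ℤ)] := by
  simp [sameRunner]

/-- If the first movement of all is the pivot of its runner but not the only movement there, then
it starts at an unoccupied position. -/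
theorem start_notMem_of_isMin (he : 0 < e) {i j : Fin w} (hi : ∀ k, i ≤ k)
    (hpiv : pivot e μ h j = i) (hij : i < j) : start e μ h i ∉ betaSet μ := by
  intro hmem
  obtain ⟨n, hn, hstart⟩ := exists_start_eq (h := h) i
  set b := bead e μ h i with hb
  set L := lastOnRunner e μ h j with hL
  have hLj : j ≤ L := le_lastOnRunner (self_mem_sameRunner e μ h j)
  have hLb : bead e μ h L = b := by rw [hb, ← hpiv, bead_pivot]
  have hmin : ∀ k, start e μ h i ≤ start e μ h k := fun k => start_mono (hi k)
  have hn1 : wt e μ b ≤ n + 1 := by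
    obtain ⟨k, hk, -⟩ := exists_movement_eq (h := h) (bead_mem (h := h) i)
      (n := wt e μ b - 1) (Nat.sub_lt (Nat.zero_lt_of_lt hn) one_pos)
    have h1 := hmin k
    rw [hk, hstart] at h1
    have h2 : ((wt e μ b - 1 : ℕ) : ℤ) ≤ n := by
      refine le_of_mul_le_mul_right ?_ (show (0 : ℤ) < e by exact_mod_cast he)
      linarith
    omega
  -- Both movements are of the bead `b`, so distinct ones have distinct starts.
  have hlt : start e μ h i < start e μ h L := by
    refine lt_of_le_of_ne (hmin L) fun heq => (hij.trans_le hLj).ne ?_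
    apply (movement e μ h).injective
    exact Prod.ext heq hLb.symm
  have hn0 : 0 < n := by
    rcases Nat.eq_zero_or_pos n with h0 | h0
    · subst h0
      have := start_le_bead (h := h) L
      rw [hLb] at this
      push_cast at hstart
      linarith
    · exact h0
  -- The weight grows by at most `n - 1` from the occupied `q_i` to `b`, where it exceeds `n`. So
  -- the bead at `q_i` has weight at least 2 and a movement from `q_i - e`, before the first one.
  have h1 := wt_le_wt_add he μ (start e μ h i + e) (n - 1)
  rw [wt_add_self he, if_pos hmem, show start e μ h i + e + ((n - 1 : ℕ) : ℤ) * e = b by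
    rw [hstart, Nat.cast_sub (by omega)]; push_cast; ring] at h1
  have h2 : 1 < wt e μ (start e μ h i) := by omega
  obtain ⟨k, hk, -⟩ := exists_movement_eq (h := h) hmem h2
  have := hmin k
  rw [hk] at this
  push_cast at this
  have : (0 : ℤ) < e := by exact_mod_cast he
  omega

/-- The first index of all is never a "next", only a "previous"; then it is the pivot and `j` is the
second movement on its runner. -/
theorem modifiedBasis_apply_of_isMin {i : Fin w} (hi : ∀ k, i ≤ k) (j : Fin w) :
    0 ≤ modifiedBasis e μ h j i ∨
      pivot e μ h j = i ∧ i < j ∧ i ∈ sameRunner e μ h j ∧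
        (∀ k ∈ sameRunner e μ h j, k < j → k = i) ∧ -1 ≤ modifiedBasis e μ h j i := by
  unfold modifiedBasis
  split_ifs with h1 h2
  · left
    have h3 := Finset.min'_mem ((sameRunner e μ h j).filter fun k => j < k)
      ⟨_, Finset.mem_filter.2 ⟨pivot_mem e μ h j, h1⟩⟩
    have h4 : i ≠ ((sameRunner e μ h j).filter fun k => j < k).min'
      ⟨_, Finset.mem_filter.2 ⟨pivot_mem e μ h j, h1⟩⟩ := fun h5 => by
        rw [← h5] at h3
        exact absurd (Finset.mem_filter.1 h3).2 (not_lt.2 (hi j))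
    rw [Pi.sub_apply, Pi.single_apply, Pi.single_apply, if_neg h4]
    split_ifs <;> simp
  · have h3 := Finset.max'_mem ((sameRunner e μ h j).filter fun k => k < j)
      ⟨_, Finset.mem_filter.2 ⟨pivot_mem e μ h j, h2⟩⟩
    have h4 := Finset.le_max' ((sameRunner e μ h j).filter fun k => k < j)
    by_cases h5 : i = ((sameRunner e μ h j).filter fun k => k < j).max'
      ⟨_, Finset.mem_filter.2 ⟨pivot_mem e μ h j, h2⟩⟩
    · right
      have h6 : ∀ k ∈ sameRunner e μ h j, k < j → k = i := fun k hk hkj =>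
        le_antisymm (h5 ▸ h4 k (Finset.mem_filter.2 ⟨hk, hkj⟩)) (hi k)
      rw [← h5] at h3
      refine ⟨h6 _ (pivot_mem e μ h j) h2, (Finset.mem_filter.1 h3).2,
        (Finset.mem_filter.1 h3).1, h6, ?_⟩
      rw [Pi.sub_apply, Pi.single_apply, Pi.single_apply]
      split_ifs <;> simp
    · left
      rw [Pi.sub_apply, Pi.single_apply, Pi.single_apply, if_neg h5]
      split_ifs <;> simp
  · left
    rw [Pi.single_apply]
    split_ifs <;> simp

/-- Only one `ε_j` can be negative at `i`, the second movement on a runner being unique; the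
unoccupied `q_i` compensates for it. -/
theorem zero_le_of_isMin (he : 0 < e) (Γ : Finset (Fin w)) {i : Fin w} (hi : ∀ k, i ≤ k) :
    0 ≤ zLabel e μ h i + (∑ j ∈ Γ, modifiedBasis e μ h j) i := by
  rw [Finset.sum_apply]
  by_cases hneg : ∃ j ∈ Γ, modifiedBasis e μ h j i < 0
  · obtain ⟨j, hj, hji⟩ := hneg
    rcases modifiedBasis_apply_of_isMin (h := h) hi j with h1 | ⟨h1, h2, h3, h4, h5⟩
    · omega
    have h6 : ∀ k ∈ Γ.erase j, 0 ≤ modifiedBasis e μ h k i := by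
      intro k hk
      rcases modifiedBasis_apply_of_isMin (h := h) hi k with g1 | ⟨g1, g2, g3, g4, g5⟩
      · exact g1
      exfalso
      rw [mem_sameRunner] at h3 g3
      rcases lt_trichotomy j k with hlt | heq | hlt
      · exact h2.ne' (g4 j (mem_sameRunner.2 (h3.symm.trans g3)) hlt)
      · exact (Finset.mem_erase.1 hk).1 heq.symm
      · exact g2.ne' (h4 k (mem_sameRunner.2 (g3.symm.trans h3)) hlt)
    have h7 : 1 ≤ zLabel e μ h i := by
      have h8 := start_notMem_of_isMin he hi h1 h2
      unfold zLabel
      have : 0 < (Set.Ioc (start e μ h i - (e : ℤ)) (start e μ h i) \ betaSet μ).ncard := by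
        rw [Set.ncard_pos ((Set.finite_Ioc _ _).subset Set.sdiff_subset)]
        exact ⟨_, ⟨by omega, le_rfl⟩, h8⟩
      omega
    rw [← Finset.add_sum_erase _ _ hj]
    have := Finset.sum_nonneg h6
    omega
  · push Not at hneg
    exact add_nonneg (zLabel_nonneg i) (Finset.sum_nonneg hneg)

end

theorem increasing_parallelotope_subset {e : ℕ} (he : 0 < e) {μ : YoungDiagram} {w : ℕ}
    (h : weight e μ = w) : increasing 4 (parallelotope e μ h) ⊆
      increasing 4 (Set.Icc (0 : Fin w → ℤ) fun _ => (e : ℤ)) := by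
  rintro z ⟨⟨Γ, rfl⟩, hz⟩
  set z := zLabel e μ h + ∑ i ∈ Γ, modifiedBasis e μ h i with hzdef
  have hmono : Monotone z := fun i j hij => by
    rcases hij.eq_or_lt with rfl | hlt
    · exact le_rfl
    · have : z i + 4 ≤ z j := add_four_le_of_lt hz hlt
      omega
  rcases Nat.eq_zero_or_pos w with rfl | hw
  · exact ⟨⟨fun i => i.elim0, fun i => i.elim0⟩, hz⟩
  refine ⟨⟨fun i => ?_, fun i => ?_⟩, hz⟩
  · have h1 := zero_le_of_isMin (h := h) he Γ (i := ⟨0, hw⟩) fun k => Fin.mk_le_of_le_val (by simp)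
    exact le_trans h1 (hmono (Fin.mk_le_of_le_val (by simp)))
  · have hlast : ∀ k : Fin w, k ≤ ⟨w - 1, by omega⟩ := fun k => Fin.le_def.2 (by
      have := k.2; simp only; omega)
    refine (hmono (hlast i)).trans ?_
    have h1 := sum_modifiedBasis_le_one (h := h) Γ ⟨w - 1, by omega⟩
    have h2 := zLabel_le_of_start_mem he (start_mem_of_isMax (h := h) hlast)
    rw [hzdef, Pi.add_apply]
    linarith

/-! ### The partition of an anchored configuration -/

/-- The set of beads obtained from `T` by adding `1_Q - 1_{Q - e}` to its indicator function. -/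
def anchoredBeads (e : ℤ) (T Q : Set ℤ) : Set ℤ :=
  {x | (x ∈ T ∧ (x + e ∈ Q → x ∈ Q)) ∨ (x ∈ Q ∧ x + e ∉ Q)}

theorem IsAnchored.add_mem {e : ℤ} (he : 0 < e) {T Q : Set ℤ} (hQ : IsAnchored e T Q) {x : ℤ}
    (hx : x ∈ Q) (hxT : x ∈ T) : x + e ∈ Q :=
  hQ.up x hx _ (modEq_add_self e x) (by omega) (by simpa using hxT)

theorem IsAnchored.mem_of_add_mem {e : ℤ} (he : 0 < e) {T Q : Set ℤ} (hQ : IsAnchored e T Q)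
    {x : ℤ} (hx : x + e ∈ Q) (hxQ : x ∉ Q) : x ∈ T := by
  by_contra h
  exact hxQ (hQ.down _ hx x (modEq_add_self e x).symm (by omega) h)

/-- The last element of `Q` on a runner is unique. -/
theorem IsAnchored.top_unique {e : ℤ} {T Q : Set ℤ} (hT : ∀ x ∈ T, x - e ∈ T)
    (hQ : IsAnchored e T Q) {b c : ℤ} (hb : b ∈ Q) (hbT : b ∉ T) (hb' : b + e ∉ Q) (hc : c ∈ Q)
    (hcT : c ∉ T) (hc' : c + e ∉ Q) (hbc : b ≡ c [ZMOD e]) : b = c := by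
  have key : ∀ {b c : ℤ}, b ∉ T → b + e ∉ Q → c ∈ Q → b ≡ c [ZMOD e] → ¬ b < c := by
    intro b c hbT hb' hc hbc hlt
    have hle := le_sub_of_modEq_of_lt hbc hlt
    rcases eq_or_ne (b + e) c with h | h
    · exact hb' (h ▸ hc)
    · exact hb' (hQ.down c hc _ ((modEq_add_self e b).trans hbc) (by omega) fun h' =>
        hbT (by simpa using hT _ h'))
  exact le_antisymm (not_lt.1 (key hcT hc' hb hbc.symm)) (not_lt.1 (key hbT hb' hc hbc))

theorem exists_top_of_mem {e : ℤ} (he : 0 < e) {Q : Finset ℤ} {x : ℤ} (hx : x ∈ Q) :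
    ∃ b ∈ Q, x ≤ b ∧ b ≡ x [ZMOD e] ∧ b + e ∉ Q := by
  obtain ⟨b, hb, hmax⟩ := (Q.filter fun y => y ≡ x [ZMOD e] ∧ x ≤ y).exists_maximal
    ⟨x, Finset.mem_filter.2 ⟨hx, Int.ModEq.refl _, le_rfl⟩⟩
  obtain ⟨hbQ, hbx, hle⟩ := Finset.mem_filter.1 hb
  refine ⟨b, hbQ, hle, hbx, fun h => ?_⟩
  have := hmax (Finset.mem_filter.2 ⟨h, (modEq_add_self _ b).trans hbx, by omega⟩)
    (by omega : b ≤ b + e)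
  omega

/-- The first position outside `T` on a runner is unique. -/
theorem root_unique {e : ℤ} (he : 0 < e) {T : Set ℤ} (hT : ∀ x ∈ T, x - e ∈ T) {b c : ℤ}
    (hb : b ∉ T) (hb' : b - e ∈ T) (hc : c ∉ T) (hc' : c - e ∈ T) (hbc : b ≡ c [ZMOD e]) :
    b = c := by
  have key : ∀ {b c : ℤ}, b ∉ T → c - e ∈ T → b ≡ c [ZMOD e] → ¬ b < c :=
    fun {b c} hb hc hbc hlt => hb (mem_of_le_of_modEq he hT hc (le_sub_of_modEq_of_lt hbc hlt)
      (hbc.trans (modEq_sub_self e c).symm))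
  exact le_antisymm (not_lt.1 (key hc hb' hbc.symm)) (not_lt.1 (key hb hc' hbc))

open scoped Classical in
-- Anchoring excludes the values 2 and -1 on the right.
theorem indicator_anchoredBeads {e : ℤ} (he : 0 < e) {T Q : Set ℤ} (hQ : IsAnchored e T Q)
    (x : ℤ) : (if x ∈ anchoredBeads e T Q then (1 : ℤ) else 0) =
      (if x ∈ T then 1 else 0) + (if x ∈ Q then 1 else 0) - if x + e ∈ Q then 1 else 0 := by
  have h1 := hQ.add_mem he (x := x)
  have h2 := hQ.mem_of_add_mem he (x := x)
  by_cases hT : x ∈ T <;> by_cases hQ1 : x ∈ Q <;> by_cases hQ2 : x + e ∈ Q <;>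
    simp_all [anchoredBeads]

open scoped Classical in
-- In a window containing `Q` and `Q - e`, which have equal size, the number of beads is that of the
-- core.
theorem exists_betaSet_eq_anchoredBeads {e : ℕ} (he : 0 < e) {κ : YoungDiagram} {Q : Finset ℤ}
    (hQ : IsAnchored e (betaSet κ) (Q : Set ℤ)) :
    ∃ μ, betaSet μ = anchoredBeads e (betaSet κ) Q := by
  obtain ⟨lo, hlo⟩ := Q.finite_toSet.bddBelow
  obtain ⟨hi, hhi⟩ := Q.finite_toSet.bddAbove
  have he' : (0 : ℤ) < e := by exact_mod_cast he
  have hlo' : ∀ x ∈ Q, lo ≤ x := fun x hx => hlo hx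
  have hhi' : ∀ x ∈ Q, x ≤ hi := fun x hx => hhi hx
  set N := max (κ.colLen 0) (e - lo).toNat with hN
  set M := max (κ.rowLen 0 : ℤ) (hi + 1) with hM
  have hN2 : -(N : ℤ) + e ≤ lo := by omega
  refine exists_betaSet_eq (N := N) (M := M) (fun x hx => ?_) (fun x hx => ?_) ?_
  · refine Or.inl ⟨mem_betaSet_of_lt (le_max_left _ _) hx, fun h => ?_⟩
    have := hlo' _ (by simpa using h)
    omega
  · rcases hx with ⟨h, -⟩ | ⟨h, -⟩
    · have := lt_of_mem_betaSet h; omega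
    · have := hhi' _ (by simpa using h); omega
  · have h1 := card_filter_mem_betaSet (μ := κ) (N := N) (M := M) (le_max_left _ _)
      (le_max_left _ _)
    obtain ⟨P, hP⟩ : ∃ P : Set ℤ, P = Q := ⟨_, rfl⟩
    have hPQ : ∀ x, x ∈ P ↔ x ∈ Q := fun x => by rw [hP, Finset.mem_coe]
    have h2 : (Finset.Ico (-N : ℤ) M).filter (· ∈ P) = Q := by
      ext x
      simp only [Finset.mem_filter, Finset.mem_Ico, hPQ, and_iff_right_iff_imp]
      intro hx
      have := hlo' x hx; have := hhi' x hx
      omega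
    have h3 : (Finset.Ico (-N : ℤ) M).filter (fun x : ℤ => x + e ∈ P) =
        Q.image fun x => x - (e : ℤ) := by
      ext x
      simp only [Finset.mem_filter, Finset.mem_Ico, hPQ, Finset.mem_image]
      constructor
      · rintro ⟨-, h⟩
        exact ⟨_, h, by ring⟩
      · rintro ⟨y, hy, rfl⟩
        have := hlo' y hy; have := hhi' y hy
        exact ⟨by omega, by simpa using hy⟩
    have h4 : ((Finset.Ico (-N : ℤ) M).filter (fun x : ℤ => x + e ∈ P)).card = Q.card := by
      rw [h3, Finset.card_image_of_injective _ (sub_left_injective)]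
    rw [← hP] at hQ ⊢
    have h5 : (((Finset.Ico (-N : ℤ) M).filter
        (· ∈ anchoredBeads e (betaSet κ) P)).card : ℤ) = N := by
      rw [Finset.natCast_card_filter]
      simp only [indicator_anchoredBeads he' hQ, Finset.sum_sub_distrib, Finset.sum_add_distrib,
        ← Finset.natCast_card_filter]
      rw [h1, h2, h4]
      ring
    exact_mod_cast h5

section

variable {e : ℕ} {κ μ : YoungDiagram} {Q : Finset ℤ}

open scoped Classical in
-- The gap indicator changes by `1_Q (x + e) - 1_Q x`, which telescopes along the runner.
theorem wt_eq_of_anchored (he : 0 < e) (hQ : IsAnchored e (betaSet κ) (Q : Set ℤ))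
    (hμ : betaSet μ = anchoredBeads e (betaSet κ) Q) (b : ℤ) :
    wt e μ b = wt e κ b + if b ∈ Q then 1 else 0 := by
  have he' : (0 : ℤ) < e := by exact_mod_cast he
  obtain ⟨lo, hlo⟩ := Q.finite_toSet.bddBelow
  have hlo' : ∀ x ∈ Q, lo ≤ x := fun x hx => hlo hx
  set K := min (lo - e) (min (-(κ.colLen 0 : ℤ)) (-(μ.colLen 0 : ℤ))) with hK
  have key : ∀ n : ℕ, ∀ b : ℤ, (b - K).toNat ≤ n →
      wt e μ b = wt e κ b + if b ∈ Q then 1 else 0 := by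
    intro n
    induction n with
    | zero =>
      intro b hb
      rw [wt_eq_zero_of_forall fun x hx _ => mem_betaSet_of_lt le_rfl (by omega),
        wt_eq_zero_of_forall fun x hx _ => mem_betaSet_of_lt le_rfl (by omega), if_neg]
      intro hbQ
      have := hlo' b hbQ
      omega
    | succ n ih =>
      intro b hb
      have h1 := wt_add_self he μ (b - e)
      have h2 := wt_add_self he κ (b - e)
      have h3 := indicator_anchoredBeads he' hQ (b - e)
      rw [sub_add_cancel] at h1 h2 h3
      rw [hμ] at h1
      simp only [Finset.mem_coe] at h3
      have h4 := ih (b - e) (by omega)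
      rw [h1, h2, h4]
      zify
      split_ifs at h3 ⊢ <;> omega
  exact key _ b le_rfl

theorem IsCore.wt_eq_zero (he : 0 < e) (hκ : IsCore e κ) {b : ℤ} (hb : b ∈ betaSet κ) :
    wt e κ b = 0 :=
  wt_eq_zero_of_forall fun _ hx hxb => mem_of_le_of_modEq (by exact_mod_cast he)
    (fun _ hy => hκ.sub_mem he hy) hb hx.le hxb

/-- The gaps of a core on a runner are consecutive, so the weight of a gap is its distance to the
first one. -/
theorem sub_wt_mul_notMem (he : 0 < e) {b : ℤ} (hb : b ∉ betaSet κ) (hκ : IsCore e κ) :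
    b - wt e κ b * e ∉ betaSet κ ∧ b - wt e κ b * e - e ∈ betaSet κ := by
  have key : ∀ n : ℕ, ∀ b : ℤ, (b + κ.colLen 0).toNat ≤ n → b ∉ betaSet κ →
      b - wt e κ b * e ∉ betaSet κ ∧ b - wt e κ b * e - e ∈ betaSet κ := by
    intro n
    induction n with
    | zero =>
      intro b hb hbT
      by_cases h : b < -(κ.colLen 0 : ℤ)
      · exact absurd (mem_betaSet_of_lt le_rfl h) hbT
      · rw [wt_eq_zero_of_forall fun x hx _ => mem_betaSet_of_lt le_rfl (by omega)]
        simp only [Nat.cast_zero, zero_mul, sub_zero]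
        exact ⟨hbT, mem_betaSet_of_lt le_rfl (by omega)⟩
    | succ n ih =>
      intro b hb hbT
      have h := wt_add_self he κ (b - e)
      rw [sub_add_cancel] at h
      by_cases hbe : b - e ∈ betaSet κ
      · rw [h, if_pos hbe, hκ.wt_eq_zero he hbe]
        simpa using ⟨hbT, hbe⟩
      · by_cases hlow : b < -(κ.colLen 0 : ℤ)
        · exact absurd (mem_betaSet_of_lt le_rfl hlow) hbT
        have h1 := ih (b - e) (by omega) hbe
        rw [h, if_neg hbe]
        push_cast
        rw [show b - ((wt e κ (b - e) : ℤ) + 1) * e = b - e - wt e κ (b - e) * e by ring]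
        exact h1
  exact key _ b le_rfl hb

/-- Beads in `T ∩ Q` move up one place, other beads in `T` stay, and the last element of `Q` on a
runner lands just before the first gap. -/
theorem isCoreOf_of_anchored (he : 0 < e) (hκ : IsCore e κ)
    (hQ : IsAnchored e (betaSet κ) (Q : Set ℤ))
    (hμ : betaSet μ = anchoredBeads e (betaSet κ) Q) : IsCoreOf e κ μ := by
  classical
  have he' : (0 : ℤ) < e := by exact_mod_cast he
  have hT : ∀ x ∈ betaSet κ, x - e ∈ betaSet κ := fun x hx => hκ.sub_mem he hx
  unfold IsCoreOf slidBeads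
  simp only [wt_eq_of_anchored he hQ hμ, hμ]
  ext t
  simp only [Set.mem_image]
  constructor
  · intro ht
    by_cases h1 : t + e ∈ Q
    · by_cases h2 : t + e ∈ betaSet κ
      · exact ⟨t + e, Or.inl ⟨h2, fun _ => h1⟩, by rw [hκ.wt_eq_zero he h2, if_pos h1]; simp⟩
      · obtain ⟨b, hbQ, hle, hbt, hbe⟩ := exists_top_of_mem he' h1
        have hbT : b ∉ betaSet κ := fun h => h2 (mem_of_le_of_modEq he' hT h hle hbt.symm)
        have h3 := sub_wt_mul_notMem he hbT hκ
        refine ⟨b, Or.inr ⟨hbQ, hbe⟩, ?_⟩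
        have h4 := root_unique he' hT h3.1 h3.2 h2 (by simpa using ht) (by
          refine Int.ModEq.trans ?_ hbt
          rw [Int.modEq_iff_dvd]
          exact ⟨wt e κ b, by ring⟩)
        rw [if_pos hbQ]
        push_cast
        linarith
    · have h2 : t ∉ Q := fun h => h1 (hQ.add_mem he' h ht)
      exact ⟨t, Or.inl ⟨ht, fun h => absurd h h1⟩, by rw [hκ.wt_eq_zero he ht, if_neg h2]; simp⟩
  · rintro ⟨b, hb, rfl⟩
    by_cases hbT : b ∈ betaSet κ
    · rw [hκ.wt_eq_zero he hbT]
      split_ifs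
      · simpa using hT b hbT
      · simpa using hbT
    · rcases hb with ⟨h, -⟩ | ⟨h, -⟩
      · exact absurd h hbT
      · rw [if_pos (by simpa using h)]
        have := (sub_wt_mul_notMem he hbT hκ).2
        push_cast
        rwa [add_mul, one_mul, ← sub_sub]

/-- Beads in `T ∩ Q` have weight 1 and form the leg of a hook; the last element of `Q` on the runner
is the arm and moves through every position of `Q` outside `T`. -/
theorem mem_movements_of_anchored (he : 0 < e) (hκ : IsCore e κ)
    (hQ : IsAnchored e (betaSet κ) (Q : Set ℤ))
    (hμ : betaSet μ = anchoredBeads e (betaSet κ) Q) (p : ℤ ×ₗ ℤ) :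
    p ∈ movements e μ ↔
      ((ofLex p).1 ∈ betaSet κ ∧ (ofLex p).1 ∈ Q ∧ (ofLex p).2 = (ofLex p).1) ∨
      ((ofLex p).1 ∉ betaSet κ ∧ (ofLex p).1 ≤ (ofLex p).2 ∧
        (ofLex p).2 ≡ (ofLex p).1 [ZMOD e] ∧ (ofLex p).2 ∈ Q ∧ (ofLex p).2 + e ∉ Q) := by
  classical
  have he' : (0 : ℤ) < e := by exact_mod_cast he
  have hT : ∀ x ∈ betaSet κ, x - e ∈ betaSet κ := fun x hx => hκ.sub_mem he hx
  rw [mem_movements]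
  obtain ⟨q, b⟩ := p
  show (b ∈ betaSet μ ∧ ∃ n < wt e μ b, q = b - n * e) ↔ (q ∈ betaSet κ ∧ q ∈ Q ∧ b = q) ∨
    (q ∉ betaSet κ ∧ q ≤ b ∧ b ≡ q [ZMOD e] ∧ b ∈ Q ∧ b + e ∉ Q)
  simp only [wt_eq_of_anchored he hQ hμ, hμ]
  have hmod : ∀ n : ℕ, b ≡ b - n * e [ZMOD e] := fun n => by
    rw [Int.modEq_iff_dvd]
    exact ⟨-n, by ring⟩
  have hle : ∀ m n : ℕ, m ≤ n → b - n * e ≤ b - m * e := fun m n h => by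
    have : (m : ℤ) * e ≤ n * e := by gcongr
    omega
  constructor
  · rintro ⟨hb, n, hn, rfl⟩
    by_cases hbT : b ∈ betaSet κ
    · rw [hκ.wt_eq_zero he hbT] at hn
      split_ifs at hn with hbQ
      · have : n = 0 := by omega
        subst this
        left
        simpa using ⟨hbT, hbQ⟩
      · omega
    · rcases hb with ⟨h, -⟩ | ⟨hbQ, hbe⟩
      · exact absurd h hbT
      · simp only [Finset.mem_coe] at hbQ hbe
        rw [if_pos hbQ] at hn
        refine Or.inr ⟨fun h => (sub_wt_mul_notMem he hbT hκ).1 ?_, by simpa using hle 0 n, hmod n,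
          hbQ, hbe⟩
        exact mem_of_le_of_modEq he' hT h (hle _ _ (by omega)) ((hmod _).symm.trans (hmod _))
  · rintro (⟨hqT, hqQ, rfl⟩ | ⟨hqT, hqb, hbq, hbQ, hbe⟩)
    · refine ⟨Or.inl ⟨hqT, fun _ => hqQ⟩, 0, by rw [if_pos hqQ]; omega, by simp⟩
    · obtain ⟨k, hk⟩ := hbq.symm.dvd
      have hk0 : 0 ≤ k := by
        by_contra hneg
        have : (e : ℤ) * k < 0 := mul_neg_of_pos_of_neg he' (by omega)
        omega
      lift k to ℕ using hk0
      have hqk : q = b - k * e := by linarith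
      have hbT : b ∉ betaSet κ := fun h => hqT (mem_of_le_of_modEq he' hT h hqb hbq.symm)
      refine ⟨Or.inr ⟨hbQ, hbe⟩, k, ?_, hqk⟩
      rw [if_pos hbQ]
      by_contra hcon
      apply hqT
      rw [hqk]
      refine mem_of_le_of_modEq he' hT (sub_wt_mul_notMem he hbT hκ).2 ?_
        ((hmod _).symm.trans ((hmod (wt e κ b)).trans (modEq_sub_self _ _).symm))
      have := hle (wt e κ b + 1) k (by omega)
      push_cast at this
      linarith

end

/-! ### Hooks in the quotient -/

theorem rowLen_one_ofRowLens_le {l : List ℕ} (hl : l.SortedGE)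
    (h : l.countP (2 ≤ ·) ≤ 1) : (YoungDiagram.ofRowLens l hl).rowLen 1 ≤ 1 := by
  by_contra hcon
  have h1 : (1, 0) ∈ YoungDiagram.ofRowLens l hl := YoungDiagram.mem_iff_lt_rowLen.2 (by omega)
  obtain ⟨hlen, -⟩ := YoungDiagram.mem_ofRowLens.1 h1
  rcases l with _ | ⟨a, _ | ⟨b, t⟩⟩
  · simp at hlen
  · simp at hlen
  have h2 : (YoungDiagram.ofRowLens (a :: b :: t) hl).rowLen 1 = b :=
    YoungDiagram.rowLen_ofRowLens (hw := hl) ⟨1, hlen⟩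
  have h3 : b ≤ a := hl.pairwise.rel_get_of_lt (a := ⟨0, by simp⟩) (b := ⟨1, hlen⟩) (by simp)
  have h4 : 2 ≤ b := by omega
  rw [List.countP_cons_of_pos (by simpa using h4.trans h3),
    List.countP_cons_of_pos (by simpa using h4)] at h
  omega

theorem isHook_quotient {e : ℕ} {μ : YoungDiagram} {r : ℤ}
    (h : ∀ b ∈ betaSet μ, ∀ c ∈ betaSet μ, b ≡ r [ZMOD (e : ℤ)] → c ≡ r [ZMOD (e : ℤ)] →
      2 ≤ wt e μ b → 2 ≤ wt e μ c → b = c) : IsHook (quotient e μ r) := by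
  refine rowLen_one_ofRowLens_le _ ?_
  rw [← Multiset.coe_countP, Multiset.sort_eq, Multiset.countP_map, ← Finset.filter_val,
    Finset.card_val, Finset.card_le_one]
  intro b hb c hc
  simp only [Finset.mem_filter, movedBeads, Set.Finite.mem_toFinset, Set.mem_ofPred_eq] at hb hc
  exact h b hb.1.1.1 c hc.1.1.1 hb.1.2 hc.1.2 hb.2 hc.2

/-! ### Potential and labels -/

open scoped Classical in
/-- The number of positions in `(x - e, x]` outside `T`. -/
noncomputable def gapCount (e : ℕ) (T : Set ℤ) (x : ℤ) : ℤ :=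
  ∑ y ∈ Finset.Ioc (x - e) x, if y ∈ T then 0 else 1

open scoped Classical in
-- The window gains `x` and loses `x - e`.
theorem gapCount_sub_gapCount {e : ℕ} (he : 0 < e) {T : Set ℤ} (hT : ∀ x ∈ T, x - (e : ℤ) ∈ T)
    (x : ℤ) : gapCount e T x - gapCount e T (x - 1) =
      if x ∉ T ∧ x - (e : ℤ) ∈ T then 1 else 0 := by
  have h1 : Finset.Ioc (x - e) x = insert x (Finset.Ioc (x - e) (x - 1)) := by
    ext y; simp only [Finset.mem_Ioc, Finset.mem_insert]; omega
  have h2 : Finset.Ioc (x - 1 - e) (x - 1) = insert (x - (e : ℤ)) (Finset.Ioc (x - e) (x - 1)) := by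
    ext y; simp only [Finset.mem_Ioc, Finset.mem_insert]; omega
  unfold gapCount
  rw [h1, h2, Finset.sum_insert (by simp), Finset.sum_insert (by simp), add_sub_add_right_eq_sub]
  have := hT x
  split_ifs <;> simp_all

theorem gapCount_of_lt {e : ℕ} {κ : YoungDiagram} {x : ℤ} (hx : x < -(κ.colLen 0 : ℤ)) :
    gapCount e (betaSet κ) x = 0 :=
  Finset.sum_eq_zero fun y hy => if_pos (mem_betaSet_of_lt le_rfl (by
    have := (Finset.mem_Ioc.1 hy).2; omega))

theorem gapCount_of_le {e : ℕ} {κ : YoungDiagram} {x : ℤ} (hx : (κ.rowLen 0 : ℤ) + e ≤ x) :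
    gapCount e (betaSet κ) x = e := by
  unfold gapCount
  rw [Finset.sum_congr rfl fun y hy => if_neg fun h => by
    have := lt_of_mem_betaSet h
    have := (Finset.mem_Ioc.1 hy).1
    omega]
  simp

theorem exists_antidifference {F : ℤ → ℤ} {lo : ℤ} (hF : ∀ x, x < lo → F x = 0) :
    ∃ Φ : ℤ → ℤ, ∀ x, Φ (x + 1) - Φ x = F x := by
  refine ⟨fun x => ∑ y ∈ Finset.Ico lo x, F y, fun x => ?_⟩
  simp only
  rcases lt_or_ge x lo with h | h
  · rw [Finset.Ico_eq_empty (by omega), Finset.Ico_eq_empty (by omega), hF x h]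
    simp
  · rw [show Finset.Ico lo (x + 1) = insert x (Finset.Ico lo x) by
      ext y; simp only [Finset.mem_Ico, Finset.mem_insert]; omega, Finset.sum_insert (by simp)]
    ring

section

variable {e : ℕ} {κ μ : YoungDiagram} {w : ℕ} {h : weight e μ = w}

open scoped Classical in
theorem indicator_range {q : Fin w → ℤ} (hq : Function.Injective q) (x : ℤ) :
    (if x ∈ Set.range q then (1 : ℤ) else 0) = ∑ j, if q j = x then 1 else 0 := by
  split_ifs with hx
  · obtain ⟨k, rfl⟩ := hx
    exact (sum_ite_eq_one_of_unique (p := fun j => q j = q k) k rfl fun j hj => hq hj).symm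
  · rw [sum_ite_eq_zero_of_forall_not fun j hj => hx ⟨j, hj⟩]

/-- Insert the indicator of the bead set. In the window lie `q_j` for `j = i`, whence the `-1`, and
for `j < i` at distance below `e`, and `q_j - e` for `j > i` at distance at most `e`. -/
theorem zLabel_eq (he : 0 < e) (hq : StrictMono (start e μ h))
    (hQ : IsAnchored e (betaSet κ) (Set.range (start e μ h)))
    (hμ : betaSet μ = anchoredBeads e (betaSet κ) (Set.range (start e μ h))) (i : Fin w) :
    zLabel e μ h i = gapCount e (betaSet κ) (start e μ h i)
      + ∑ j, (if i < j ∧ start e μ h j - start e μ h i ≤ e then (1 : ℤ) else 0)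
      - ∑ j, (if j < i ∧ start e μ h i - start e μ h j < e then (1 : ℤ) else 0) - 1 := by
  classical
  have he' : (0 : ℤ) < e := by exact_mod_cast he
  set q := start e μ h with hqdef
  have h1 : zLabel e μ h i = ∑ x ∈ Finset.Ioc (q i - e) (q i),
      (1 - if x ∈ betaSet μ then (1 : ℤ) else 0) := by
    unfold zLabel
    rw [show Set.Ioc (start e μ h i - (e : ℤ)) (start e μ h i) \ betaSet μ =
      ((Finset.Ioc (q i - e) (q i)).filter (· ∉ betaSet μ) : Finset ℤ) by ext x; simp [hqdef],
      Set.ncard_coe_finset, Finset.natCast_card_filter]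
    exact Finset.sum_congr rfl fun x _ => by split_ifs <;> simp
  have h2 : ∀ x, (1 - if x ∈ betaSet μ then (1 : ℤ) else 0) =
      (if x ∈ betaSet κ then 0 else 1) - (∑ j, if q j = x then 1 else 0)
        + ∑ j, if q j = x + e then 1 else 0 := by
    intro x
    have := indicator_anchoredBeads he' hQ x
    rw [← hμ] at this
    rw [← indicator_range hq.injective, ← indicator_range hq.injective, this]
    split_ifs <;> simp
  rw [h1]
  simp only [h2, Finset.sum_add_distrib, Finset.sum_sub_distrib]
  rw [Finset.sum_comm, Finset.sum_comm (s := Finset.Ioc (q i - e) (q i))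
    (f := fun x j => if q j = x + e then (1 : ℤ) else 0)]
  have h3 : ∑ j, ∑ x ∈ Finset.Ioc (q i - e) (q i), (if q j = x then (1 : ℤ) else 0) =
      ∑ j, (if j < i ∧ q i - q j < e then (1 : ℤ) else 0) + 1 := by
    rw [show (∑ j, (if j < i ∧ q i - q j < e then (1 : ℤ) else 0) + 1) =
      ∑ j, ((if j < i ∧ q i - q j < e then (1 : ℤ) else 0) + if j = i then 1 else 0) by
        simp [Finset.sum_add_distrib]]
    refine Finset.sum_congr rfl fun j _ => ?_
    rw [Finset.sum_ite_eq]
    simp only [Finset.mem_Ioc]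
    rcases lt_trichotomy j i with hj | rfl | hj
    · have := hq hj
      rw [if_neg hj.ne]
      split_ifs <;> omega
    · simp [he]
    · have := hq hj
      rw [if_neg hj.ne', if_neg (by omega), if_neg (by omega)]
      rfl
  have h4 : ∑ j, ∑ x ∈ Finset.Ioc (q i - e) (q i), (if q j = x + e then (1 : ℤ) else 0) =
      ∑ j, (if i < j ∧ q j - q i ≤ e then (1 : ℤ) else 0) := by
    refine Finset.sum_congr rfl fun j _ => ?_
    simp only [show ∀ x, q j = x + e ↔ q j - e = x from fun x => sub_eq_iff_eq_add.symm]
    rw [Finset.sum_ite_eq]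
    simp only [Finset.mem_Ioc, ← hq.lt_iff_lt]
    split_ifs <;> omega
  rw [h3, h4]
  unfold gapCount
  ring

theorem bead_cases (he : 0 < e) (hκ : IsCore e κ) {Q : Finset ℤ}
    (hQ : IsAnchored e (betaSet κ) (Q : Set ℤ))
    (hμ : betaSet μ = anchoredBeads e (betaSet κ) Q) (i : Fin w) :
    (start e μ h i ∈ betaSet κ ∧ start e μ h i ∈ Q ∧ bead e μ h i = start e μ h i) ∨
      (start e μ h i ∉ betaSet κ ∧ start e μ h i ≤ bead e μ h i ∧
        bead e μ h i ≡ start e μ h i [ZMOD e] ∧ bead e μ h i ∈ Q ∧ bead e μ h i + e ∉ Q) :=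
  (mem_movements_of_anchored he hκ hQ hμ _).1 (movement_mem i)

/-- The last movement on the runner moves the bead at the end of `Q`, whose movements start at all
positions of `Q` outside `T`; the first of these is the first gap. -/
theorem pivot_isRoot (he : 0 < e) (hκ : IsCore e κ) {Q : Finset ℤ}
    (hQ : IsAnchored e (betaSet κ) (Q : Set ℤ))
    (hμ : betaSet μ = anchoredBeads e (betaSet κ) Q) (hq : StrictMono (start e μ h))
    (hrange : Set.range (start e μ h) = Q) (i : Fin w) :
    start e μ h (pivot e μ h i) ∉ betaSet κ ∧ start e μ h (pivot e μ h i) - e ∈ betaSet κ := by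
  have he' : (0 : ℤ) < e := by exact_mod_cast he
  have hT : ∀ x ∈ betaSet κ, x - e ∈ betaSet κ := fun x hx => hκ.sub_mem he hx
  have hmem : ∀ j, start e μ h j ∈ (Q : Set ℤ) := fun j => hrange ▸ ⟨j, rfl⟩
  have hexists : ∀ x ∈ (Q : Set ℤ), ∃ j, start e μ h j = x := fun x hx => by
    rwa [← hrange] at hx
  set L := lastOnRunner e μ h i with hL
  set p := pivot e μ h i with hp
  have hLs : start e μ h L ≡ start e μ h i [ZMOD (e : ℤ)] :=
    mem_sameRunner.1 (lastOnRunner_mem_sameRunner i)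
  have hLT : start e μ h L ∉ betaSet κ := fun hLT => by
    obtain ⟨j, hj⟩ := hexists _ (hQ.add_mem he' (hmem L) hLT)
    have h1 : j ≤ L := le_lastOnRunner (mem_sameRunner.2 (by
      rw [hj]; exact (modEq_add_self _ _).trans hLs))
    have := hq.monotone h1
    omega
  have hps : start e μ h p ≡ start e μ h i [ZMOD (e : ℤ)] := mem_sameRunner.1 (pivot_mem e μ h i)
  have hbead : bead e μ h p = bead e μ h L := bead_pivot i
  obtain ⟨-, hLle, hLmod, hLQ, hLe⟩ :=
    (bead_cases (h := h) he hκ hQ hμ L).resolve_left fun h1 => hLT h1.1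
  have hpT : start e μ h p ∉ betaSet κ := fun hpT => by
    rcases bead_cases (h := h) he hκ hQ hμ p with ⟨-, -, h1⟩ | ⟨h1, -⟩
    · rw [← hbead, h1] at hLmod hLle
      exact hLT (mem_of_le_of_modEq he' hT hpT hLle hLmod.symm)
    · exact h1 hpT
  refine ⟨hpT, ?_⟩
  by_contra hpe
  obtain ⟨j, hj⟩ := hexists _ (hQ.down _ (hmem p) _ (modEq_sub_self _ _) (by omega) hpe)
  have hjs : start e μ h j ≡ start e μ h i [ZMOD (e : ℤ)] := by
    rw [hj]; exact (modEq_sub_self _ _).trans hps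
  obtain ⟨-, hjle, hjmod, hjQ, hje⟩ :=
    (bead_cases (h := h) he hκ hQ hμ j).resolve_left fun h1 => hpe (hj ▸ h1.1)
  have hjT : bead e μ h j ∉ betaSet κ := fun h1 => hpe (hj ▸
    mem_of_le_of_modEq he' hT h1 hjle hjmod.symm)
  have hLT' : bead e μ h L ∉ betaSet κ := fun h1 => hLT
    (mem_of_le_of_modEq he' hT h1 hLle hLmod.symm)
  have h2 := hQ.top_unique hT hjQ hjT hje hLQ hLT' hLe
    (hjmod.trans (hjs.trans (hLs.symm.trans hLmod.symm)))
  have h3 : p ≤ j := pivot_le (mem_sameRunner.2 hjs) h2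
  have := hq.monotone h3
  omega

theorem lt_pivot_iff (he : 0 < e) (hκ : IsCore e κ) {Q : Finset ℤ}
    (hQ : IsAnchored e (betaSet κ) (Q : Set ℤ))
    (hμ : betaSet μ = anchoredBeads e (betaSet κ) Q) (hq : StrictMono (start e μ h))
    (hrange : Set.range (start e μ h) = Q) (i : Fin w) :
    (i < pivot e μ h i ↔ start e μ h i ∈ betaSet κ) ∧
      (pivot e μ h i < i ↔ start e μ h i - e ∉ betaSet κ) := by
  have he' : (0 : ℤ) < e := by exact_mod_cast he
  have hT : ∀ x ∈ betaSet κ, x - e ∈ betaSet κ := fun x hx => hκ.sub_mem he hx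
  obtain ⟨h1, h2⟩ := pivot_isRoot he hκ hQ hμ hq hrange i
  have h3 : start e μ h (pivot e μ h i) ≡ start e μ h i [ZMOD (e : ℤ)] :=
    mem_sameRunner.1 (pivot_mem e μ h i)
  rw [← hq.lt_iff_lt, ← hq.lt_iff_lt]
  refine ⟨⟨fun hlt => ?_, fun hi => ?_⟩, ⟨fun hlt hi => ?_, fun hi => ?_⟩⟩
  · exact mem_of_le_of_modEq he' hT h2 (le_sub_of_modEq_of_lt h3.symm hlt)
      (h3.symm.trans (modEq_sub_self _ _).symm)
  · by_contra hle
    exact h1 (mem_of_le_of_modEq he' hT hi (not_lt.1 hle) h3)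
  · exact h1 (mem_of_le_of_modEq he' hT hi (le_sub_of_modEq_of_lt h3 hlt)
      (h3.trans (modEq_sub_self _ _).symm))
  · by_contra hle
    exact hi (mem_of_le_of_modEq he' hT h2 (by omega)
      ((modEq_sub_self _ _).trans (h3.symm.trans (modEq_sub_self _ _).symm)))

open scoped Classical in
-- Starts on a runner are consecutive, so "next" before the pivot is `q_j + e` and "previous" after
-- it is `q_j - e`: the parent of `j` in both cases.
theorem modifiedBasis_eq (he : 0 < e) (hκ : IsCore e κ) {Q : Finset ℤ}
    (hQ : IsAnchored e (betaSet κ) (Q : Set ℤ))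
    (hμ : betaSet μ = anchoredBeads e (betaSet κ) Q) (hq : StrictMono (start e μ h))
    (hrange : Set.range (start e μ h) = Q) (i j : Fin w) :
    modifiedBasis e μ h j i = (if j = i then 1 else 0)
      - if IsChild e (betaSet κ) (start e μ h) i j then 1 else 0 := by
  have he' : (0 : ℤ) < e := by exact_mod_cast he
  have hT : ∀ x ∈ betaSet κ, x - e ∈ betaSet κ := fun x hx => hκ.sub_mem he hx
  have hmem : ∀ j, start e μ h j ∈ (Q : Set ℤ) := fun j => hrange ▸ ⟨j, rfl⟩
  have hexists : ∀ x ∈ (Q : Set ℤ), ∃ j, start e μ h j = x := fun x hx => by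
    rwa [← hrange] at hx
  obtain ⟨hp1, hp2⟩ := lt_pivot_iff he hκ hQ hμ hq hrange j
  have hsub : ∀ k, (start e μ h i = start e μ h k ↔ IsChild e (betaSet κ) (start e μ h) i j) →
      (Pi.single j 1 - Pi.single k 1 : Fin w → ℤ) i = (if j = i then 1 else 0)
        - if IsChild e (betaSet κ) (start e μ h) i j then 1 else 0 := fun k hk => by
    simp only [Pi.sub_apply, Pi.single_apply, ← hk, hq.injective.eq_iff, eq_comm (a := i)]
  by_cases h1 : j < pivot e μ h j
  · rw [modifiedBasis, dif_pos h1]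
    have hj := hp1.1 h1
    obtain ⟨k, hk⟩ := hexists _ (hQ.add_mem he' (hmem j) hj)
    have hkf : k ∈ (sameRunner e μ h j).filter fun k => j < k :=
      Finset.mem_filter.2 ⟨mem_sameRunner.2 (by rw [hk]; exact modEq_add_self _ _),
        hq.lt_iff_lt.1 (by omega)⟩
    have hmin := Finset.min'_mem _ ⟨k, hkf⟩
    have hle := hq.monotone (Finset.min'_le _ _ hkf)
    have hge := le_sub_of_modEq_of_lt (mem_sameRunner.1 (Finset.mem_filter.1 hmin).1).symm
      (hq (Finset.mem_filter.1 hmin).2)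
    refine hsub _ ⟨fun h3 => Or.inl ⟨hj, by omega⟩, ?_⟩
    rintro (⟨-, h3⟩ | ⟨h3, -⟩)
    · omega
    · exact absurd (hT _ hj) h3
  by_cases h2 : pivot e μ h j < j
  · rw [modifiedBasis, dif_neg h1, dif_pos h2]
    have hj := hp2.1 h2
    obtain ⟨k, hk⟩ := hexists _ (hQ.down _ (hmem j) _ (modEq_sub_self _ _) (by omega) hj)
    have hkf : k ∈ (sameRunner e μ h j).filter fun k => k < j :=
      Finset.mem_filter.2 ⟨mem_sameRunner.2 (by rw [hk]; exact modEq_sub_self _ _),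
        hq.lt_iff_lt.1 (by omega)⟩
    have hmax := Finset.max'_mem _ ⟨k, hkf⟩
    have hge := hq.monotone (Finset.le_max' _ _ hkf)
    have hle := le_sub_of_modEq_of_lt (mem_sameRunner.1 (Finset.mem_filter.1 hmax).1)
      (hq (Finset.mem_filter.1 hmax).2)
    refine hsub _ ⟨fun h3 => Or.inr ⟨hj, by omega⟩, ?_⟩
    rintro (⟨h3, -⟩ | ⟨-, h3⟩)
    · exact absurd (hT _ h3) hj
    · omega
  · rw [modifiedBasis, dif_neg h1, dif_neg h2, Pi.single_apply]
    have hchild : ¬ IsChild e (betaSet κ) (start e μ h) i j := by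
      rintro (⟨h3, -⟩ | ⟨h3, -⟩)
      · exact h1 (hp1.2 h3)
      · exact h2 (hp2.2 h3)
    simp only [if_neg hchild, sub_zero, eq_comm (a := i)]

end

/-- An anchored configuration is the set of starting positions of the movements of its
partition. -/
theorem exists_start_eq_of_anchored {e : ℕ} (he : 0 < e) {κ : YoungDiagram} (hκ : IsCore e κ)
    {w : ℕ} {q : Fin w → ℤ} (hq : StrictMono q) {Q : Finset ℤ} (hrange : Set.range q = Q)
    (hQ : IsAnchored e (betaSet κ) (Q : Set ℤ)) {μ : YoungDiagram}
    (hμ : betaSet μ = anchoredBeads e (betaSet κ) Q) :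
    ∃ h : weight e μ = w, start e μ h = q := by
  have he' : (0 : ℤ) < e := by exact_mod_cast he
  have hT : ∀ x ∈ betaSet κ, x - e ∈ betaSet κ := fun x hx => hκ.sub_mem he hx
  have hmov := mem_movements_of_anchored he hκ hQ hμ
  -- A start determines its bead: itself in `T`, the last element of `Q` on the runner outside `T`.
  have hinj : Set.InjOn (fun p : ℤ ×ₗ ℤ => (ofLex p).1) (movements e μ) := by
    intro p hp p' hp' heq
    simp only at heq
    refine Prod.ext heq (?_ : (ofLex p).2 = (ofLex p').2)
    rcases (hmov p).1 hp with ⟨h1, h2, h3⟩ | ⟨h1, h2, h3, h4, h5⟩ <;>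
      rcases (hmov p').1 hp' with ⟨g1, g2, g3⟩ | ⟨g1, g2, g3, g4, g5⟩
    · rw [h3, g3, heq]
    · exact absurd (heq ▸ h1) g1
    · exact absurd (heq ▸ g1) h1
    · refine hQ.top_unique hT h4 (fun h6 => h1 ?_) h5 g4 (fun h6 => g1 ?_) g5
        (h3.trans (heq ▸ g3.symm))
      · exact mem_of_le_of_modEq he' hT h6 h2 h3.symm
      · exact mem_of_le_of_modEq he' hT h6 g2 g3.symm
  have himage : (movements e μ).image (fun p : ℤ ×ₗ ℤ => (ofLex p).1) = Q := by
    ext x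
    rw [Finset.mem_image]
    constructor
    · rintro ⟨p, hp, rfl⟩
      rcases (hmov p).1 hp with ⟨h1, h2, h3⟩ | ⟨h1, h2, h3, h4, h5⟩
      · exact h2
      · rcases h2.eq_or_lt with h6 | h6
        · rw [h6]; exact h4
        · exact hQ.down _ h4 _ h3.symm h6 h1
    · intro hx
      by_cases hxT : x ∈ betaSet κ
      · exact ⟨toLex (x, x), (hmov _).2 (Or.inl ⟨hxT, hx, rfl⟩), rfl⟩
      · obtain ⟨b, hb, hle, hmod, hbe⟩ := exists_top_of_mem he' hx
        exact ⟨toLex (x, b), (hmov _).2 (Or.inr ⟨hxT, hle, hmod, hb, hbe⟩), rfl⟩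
  have hcard : Q.card = w := by
    have : Q = Finset.univ.image q := by
      apply Finset.coe_injective
      rw [← hrange]
      simp
    rw [this, Finset.card_image_of_injective _ hq.injective, Finset.card_univ, Fintype.card_fin]
  have h : weight e μ = w := by
    rw [← card_movements, ← hcard, ← himage, Finset.card_image_of_injOn hinj]
  refine ⟨h, ?_⟩
  have hsm : StrictMono (start e μ h) := by
    refine start_mono.strictMono_of_injective fun i j hij => ?_
    exact (movement e μ h).injective (hinj (movement_mem i) (movement_mem j) hij)
  refine (hsm.range_inj hq).1 ?_
  rw [hrange, ← himage]
  ext x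
  simp only [Set.mem_range, Finset.coe_image, Set.mem_image, Finset.mem_coe]
  constructor
  · rintro ⟨i, rfl⟩
    exact ⟨_, movement_mem i, rfl⟩
  · rintro ⟨p, hp, rfl⟩
    have : p ∈ Set.range (movement e μ h) := by
      rw [movement, Finset.range_orderEmbOfFin]
      exact hp
    obtain ⟨i, rfl⟩ := this
    exact ⟨i, rfl⟩

/-- A bead of weight at least 2 lies outside `T`, so it is the last element of `Q` on its runner. -/
theorem isHookQuotient_of_anchored {e : ℕ} (he : 0 < e) {κ : YoungDiagram} (hκ : IsCore e κ)
    {Q : Finset ℤ} (hQ : IsAnchored e (betaSet κ) (Q : Set ℤ)) {μ : YoungDiagram}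
    (hμ : betaSet μ = anchoredBeads e (betaSet κ) Q) : IsHookQuotient e μ := by
  classical
  have hT : ∀ x ∈ betaSet κ, x - e ∈ betaSet κ := fun x hx => hκ.sub_mem he hx
  intro r _
  have key : ∀ b ∈ betaSet μ, 2 ≤ wt e μ b → b ∉ betaSet κ ∧ b ∈ Q ∧ b + e ∉ Q := by
    intro b hb hwt
    have hbT : b ∉ betaSet κ := fun hbT => by
      rw [wt_eq_of_anchored he hQ hμ, hκ.wt_eq_zero he hbT] at hwt
      split_ifs at hwt <;> omega
    rw [hμ] at hb
    exact ⟨hbT, hb.resolve_left fun h => hbT h.1⟩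
  refine isHook_quotient fun b hb c hc hbr hcr hb2 hc2 => ?_
  obtain ⟨h1, h2, h3⟩ := key b hb hb2
  obtain ⟨g1, g2, g3⟩ := key c hc hc2
  exact hQ.top_unique hT h2 h1 h3 g2 g1 g3 (hbr.trans hcr.symm)

/-! ### Covering the cube -/

theorem exists_mem_parallelotope {e : ℕ} (he : 0 < e) {w : ℕ} {κ : YoungDiagram}
    (hκ : IsCore e κ) {z : Fin w → ℤ} (hz : ∀ i, 0 ≤ z i ∧ z i ≤ e)
    (hz4 : ∀ i j : Fin w, (j : ℕ) = (i : ℕ) + 1 → 4 ≤ z j - z i) :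
    ∃ μ, ∃ hμ : μ ∈ block e κ w, IsHookQuotient e μ ∧ z ∈ parallelotope e μ hμ.2 := by
  classical
  have he' : (0 : ℤ) < e := by exact_mod_cast he
  have hT : ∀ x ∈ betaSet κ, x - e ∈ betaSet κ := fun x hx => hκ.sub_mem he hx
  have hF := gapCount_sub_gapCount he hT
  have hlo : ∀ x, x < -(κ.colLen 0 : ℤ) → gapCount e (betaSet κ) x = 0 :=
    fun x hx => gapCount_of_lt hx
  obtain ⟨Φ, hΦ⟩ := exists_antidifference hlo
  obtain ⟨q, hq, hg, hrigid⟩ := exists_rigid_isGroundState he' hΦ hlo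
    (fun x hx => gapCount_of_le hx) (fun x => by rw [hF]; split_ifs <;> simp)
    (fun x => by rw [hF]; split_ifs <;> simp) hz hz4
  have hanch := isAnchored_of_rigid he' hT hF hrigid
  obtain ⟨Γ, hΓ⟩ := exists_coefficients he' hT hΦ hF hq hanch hg
  obtain ⟨Q, hQrange⟩ : ∃ Q : Finset ℤ, Set.range q = Q := ⟨Finset.univ.image q, by simp⟩
  have hQ := hQrange ▸ hanch
  obtain ⟨μ, hμ⟩ := exists_betaSet_eq_anchoredBeads he hQ
  -- The minimiser now is the vector of starts of `μ`, so `hΓ` becomes a statement about the labels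
  -- of `μ`.
  obtain ⟨h, rfl⟩ := exists_start_eq_of_anchored he hκ hq hQrange hQ hμ
  refine ⟨μ, ⟨isCoreOf_of_anchored he hκ hQ hμ, h⟩, isHookQuotient_of_anchored he hκ hQ hμ, Γ, ?_⟩
  funext i
  have h1 := zLabel_eq he hq hanch (hQrange ▸ hμ) i
  have h2 := hΓ i
  rw [← h1] at h2
  simp only [Pi.add_apply, Finset.sum_apply, modifiedBasis_eq he hκ hQ hμ hq hQrange,
    Finset.sum_sub_distrib, Finset.sum_ite_eq']
  have h3 : ∑ j, (if IsChild e (betaSet κ) (start e μ h) i j ∧ j ∈ Γ then (1 : ℤ) else 0) =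
      ∑ j ∈ Γ, if IsChild e (betaSet κ) (start e μ h) i j then 1 else 0 := by
    rw [← Finset.sum_subset (Finset.subset_univ Γ) fun j _ hj => by simp [hj]]
    exact Finset.sum_congr rfl fun j hj => by simp [hj]
  rw [h3] at h2
  linarith

end Abacus

theorem proposition8p1 (e : ℕ) (he : 2 ≤ e) (w : ℕ) (κ : YoungDiagram)
    (hκ : Abacus.IsCore e κ) :
    (⋃ (μ : YoungDiagram) (hμ : μ ∈ Abacus.block e κ w) (_ : Abacus.IsHookQuotient e μ),
        Abacus.increasing 4 (Abacus.parallelotope e μ hμ.2)) =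
      Abacus.increasing 4 (Set.Icc (0 : Fin w → ℤ) (fun _ => (e : ℤ))) := by
  have he0 : 0 < e := by omega
  refine Set.Subset.antisymm ?_ ?_
  · simp only [Set.iUnion_subset_iff]
    exact fun μ hμ _ => Abacus.increasing_parallelotope_subset he0 hμ.2
  · rintro z ⟨⟨h0, h1⟩, hz⟩
    obtain ⟨μ, hμ, hhook, hmem⟩ := Abacus.exists_mem_parallelotope he0 hκ
      (fun i => ⟨h0 i, h1 i⟩) hz
    simp only [Set.mem_iUnion]
    exact ⟨μ, hμ, hhook, hmem, hz⟩
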